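/- For $k\ge 1$ let $P_k$ be the partially ordered pattern on labels $1,\dots,k$ in which $k$ is larger than each of the pairwise incomparable labels $1,\dots,k-1$; a permutation contains $P_k$ if some element has at least $k-1$ smaller elements to its left. Let $S_n(2413,3142)$ be the set of permutations of $\{1,\dots,n\}$ avoiding $2413$ and $3142$ (the separable permutations), and let $S_n(2413,3142,P_k)$ be the subset of those which also avoid $P_k$. Write $\mathrm{lmax}(\pi)$ and $\mathrm{rmax}(\pi)$ for the numbers of left-to-right and right-to-left maxima of $\pi$, and put $w(\pi)=u^{\mathrm{lmax}(\pi)}v^{\mathrm{rmax}(\pi)}$. For $k\ge 2$ and $0\le i\le k-2$ define the formal power series in $x$ over $\mathbb Z[u,v]$ $$F_k(x,u,v)=\sum_{n\ge 0}x^n\sum_{\pi\in S_n(2413,3142,P_k)}w(\pi),\qquad f_{k,i}(x,u,v)=\sum_{n\ge 1}x^n\sum_{\pi}w(\pi),\qquad g_{k,i}(x,u,v)=\sum_{n\ge 2}x^n\sum_{\sigma}w(\sigma),$$ where $\pi$ (resp. $\sigma$) runs over the permutations in $S_n(2413,3142,P_k)$ with exactly $i$ elements to the left of $n$ and with $n-1$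 (if it exists) to the right (resp. left) of $n$. Let $X_n(u,v)=\sum_{\pi\in S_n(2413,3142)}w(\pi)$. Then for every $k\ge 2$ these series satisfy $$F_k(x,u,v)=1+\sum_{i=0}^{k-2}\bigl(f_{k,i}(x,u,v)+g_{k,i}(x,u,v)\bigr),$$ and, for $1\le i\le k-2$, $$f_{k,i}(x,u,v)=\bigl(F_{k-i}(x,1,v)-1\bigr)\sum_{j=1}^{i}X_j(u,1)\,x^j f_{k,i-j}(x,u,v),$$ $$g_{k,i}(x,u,v)=uvx^{i+1}X_i(u,1)F_k(x,1,v)+\sum_{j=1}^{i-1}X_j(u,1)\,x^j\bigl(F_{k-i+j}(x,1,v)-1\bigr)g_{k,i-j}(x,u,v),$$ with the initial conditions $$f_{k,0}(x,u,v)=uvxF_k(x,1,v),\qquad g_{k,0}(x,u,v)=0,\qquad f_{2,0}(x,u,v)=\frac{uvx}{1-vx}.$$ Moreover the system determines these series: for every $k\ge 2$, if families of formal power series over $\mathbb Z[u,v]$, indexed by $m$ (and $i$) with $2\le m\le k$ and $0\le i\le m-2$, satisfy the above equations and initial conditions for all $m$ with $2\le m\le k$, then their members at level $k$ are $F_k$,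 $f_{k,i}$ and $g_{k,i}$ ($0\le i\le k-2$). -/

import Mathlib

noncomputable section

namespace FlatPOP

open Equiv PowerSeries

/-! ### Patterns in permutations

A permutation of length `n` is `π : Perm (Fin n)`; its one-line notation is
`π 0, π 1, …, π (n-1)`, with the letters `1, …, n` shifted to `0, …, n-1`. -/

/-- `π` contains the classical pattern `τ`: some subsequence of `π` is order-isomorphic to `τ`. -/
def ContainsPattern {k n : ℕ} (τ : Fin k → ℕ) (π : Perm (Fin n)) : Prop :=
  ∃ e : Fin k ↪o Fin n, ∀ a b : Fin k, π (e a) < π (e b) ↔ τ a < τ b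

/-- `π` contains the partially ordered pattern given by the strict order relation `r` on the
labels: some subsequence of `π` (indexed by the labels, in increasing order of position)
respects all the relations of the poset, incomparable labels being unconstrained. -/
def ContainsPOP {k n : ℕ} (r : Fin k → Fin k → Prop) (π : Perm (Fin n)) : Prop :=
  ∃ e : Fin k ↪o Fin n, ∀ a b : Fin k, r a b → π (e a) < π (e b)

/-- The strict order of the flat poset `P_k` on `k` labels: the last label is above each of the
other `k - 1` labels, which are pairwise incomparable. -/
def flatRel (k : ℕ) (a b : Fin k) : Prop := (a : ℕ) + 1 < k ∧ (b : ℕ) + 1 = k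

/-- The set `S_n(2413, 3142)` of separable permutations of length `n`. -/
def separable (n : ℕ) : Set (Perm (Fin n)) :=
  {π | ¬ ContainsPattern ![2, 4, 1, 3] π ∧ ¬ ContainsPattern ![3, 1, 4, 2] π}

/-- The set `S_n(2413, 3142, P_k)`. -/
def sepAvoid (k n : ℕ) : Set (Perm (Fin n)) :=
  {π | π ∈ separable n ∧ ¬ ContainsPOP (flatRel k) π}

/-! ### Statistics -/

/-- The number of left-to-right maxima. -/
def lmax {n : ℕ} (π : Perm (Fin n)) : ℕ := {i : Fin n | ∀ j, j < i → π j < π i}.ncard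

/-- The number of right-to-left maxima. -/
def rmax {n : ℕ} (π : Perm (Fin n)) : ℕ := {i : Fin n | ∀ j, i < j → π j < π i}.ncard

/-- Exactly `i` elements are to the left of the largest element `n`, and `n - 1`, if it exists,
is to the right of `n`. No permutation of length `0` has this property. -/
def MaxAtNextRight {n : ℕ} (i : ℕ) (π : Perm (Fin n)) : Prop :=
  ∃ p : Fin n, (π p : ℕ) + 1 = n ∧ (p : ℕ) = i ∧ ∀ q : Fin n, (π q : ℕ) + 2 = n → p < q

/-- Exactly `i` elements are to the left of the largest element `n`, and `n - 1` exists and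
is to the left of `n`. Only permutations of length at least `2` can have this property. -/
def MaxAtNextLeft {n : ℕ} (i : ℕ) (π : Perm (Fin n)) : Prop :=
  ∃ p : Fin n, (π p : ℕ) + 1 = n ∧ (p : ℕ) = i ∧ ∃ q : Fin n, (π q : ℕ) + 2 = n ∧ q < p

/-! ### Generating functions -/

/-- The polynomial ring `ℤ[u, v]`. -/
abbrev Poly : Type := MvPolynomial (Fin 2) ℤ

/-- The variable `u`, marking left-to-right maxima. -/
def u : Poly := MvPolynomial.X 0

/-- The variable `v`, marking right-to-left maxima. -/
def v : Poly := MvPolynomial.X 1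

/-- Formal power series in `x` over `ℤ[u, v]`; the variable `x` is `PowerSeries.X`. -/
abbrev Series : Type := PowerSeries Poly

/-- The polynomial `∑_{π ∈ S} u ^ lmax π * v ^ rmax π`. -/
def weightSum {n : ℕ} (S : Set (Perm (Fin n))) : Poly :=
  ∑ π ∈ S.toFinite.toFinset, u ^ lmax π * v ^ rmax π

/-- `F_k(x, u, v)`. -/
def genF (k : ℕ) : Series := PowerSeries.mk fun n => weightSum (sepAvoid k n)

/-- `f_{k,i}(x, u, v)`. -/
def genf (k i : ℕ) : Series :=
  PowerSeries.mk fun n => weightSum {π | π ∈ sepAvoid k n ∧ MaxAtNextRight i π}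

/-- `g_{k,i}(x, u, v)`. -/
def geng (k i : ℕ) : Series :=
  PowerSeries.mk fun n => weightSum {π | π ∈ sepAvoid k n ∧ MaxAtNextLeft i π}

/-- `X_n(u, v)`, the joint distribution of `lmax` and `rmax` on separable permutations. -/
def sepPoly (n : ℕ) : Poly := weightSum (separable n)

/-- `X_n(u, 1)`. -/
def sepPolyU (n : ℕ) : Poly := MvPolynomial.aeval ![u, 1] (sepPoly n)

/-- The substitution `u = 1` in a power series: `F(x, u, v) ↦ F(x, 1, v)`. -/
def atU1 : Series →+* Series :=
  PowerSeries.map (MvPolynomial.aeval (R := ℤ) ![(1 : Poly), v]).toRingHom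

/-- The quotient `uvx / (1 - vx)` of formal power series (the denominator has constant
coefficient `1`, hence is invertible). -/
def geomUV : Series :=
  PowerSeries.C (u * v) * X * PowerSeries.invOfUnit (1 - PowerSeries.C v * X) 1

/-- The system of functional equations at level `k`, for series `F_m(x, u, v)`,
`f_{m,i}(x, u, v)` and `g_{m,i}(x, u, v)`. -/
structure SystemAt (k : ℕ) (F : ℕ → Series) (f g : ℕ → ℕ → Series) : Prop where
  F_eq : F k = 1 + ∑ i ∈ Finset.range (k - 1), (f k i + g k i)
  f_eq : ∀ i, 1 ≤ i → i + 2 ≤ k →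
    f k i = (atU1 (F (k - i)) - 1) *
      ∑ j ∈ Finset.Icc 1 i, PowerSeries.C (sepPolyU j) * X ^ j * f k (i - j)
  g_eq : ∀ i, 1 ≤ i → i + 2 ≤ k →
    g k i = PowerSeries.C (u * v) * X ^ (i + 1) * PowerSeries.C (sepPolyU i) * atU1 (F k) +
      ∑ j ∈ Finset.Icc 1 (i - 1),
        PowerSeries.C (sepPolyU j) * X ^ j * (atU1 (F (k - i + j)) - 1) * g k (i - j)
  f_zero : f k 0 = PowerSeries.C (u * v) * X * atU1 (F k)
  g_zero : g k 0 = 0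
  f_two_zero : f 2 0 = geomUV

end FlatPOP

end

/-!
A permutation is handled as its one-line notation, a list of natural numbers that is a
rearrangement of `0, …, n - 1`, and it is cut at its maximum into a left part `L` and a right part
`R`. Avoiding `2413` forces the letters of `R` above a given letter of `L` to precede those below
it, and avoiding `3142` forces the letters of `L` above a given letter of `R` to follow those below
it (`SepList.exists_right`, `SepList.exists_left`). So the letters around the maximum `N` form
blocks `… A₂ A₁ N B₁ B₂ …` in which smaller indices mean larger letters.

Taking off the two innermost blocks `A`, `B` shows the permutation as the inflation of the maximum
of a shorter separable permutation `K m S` by `A N B`. As `2413` and `3142` are simple, the inflation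
is separable exactly if `K m S`, `A` and `B` are (`sepList_inflate_iff`). If `N - 1` is to the right
of `N`, then `B` is above `A`, and a letter of `B` has all `i` letters to the left of `N` below it;
so `B` runs over the nonempty permutations avoiding `P_{k-i}`. If `N - 1` is to the left, then `A` is
above `B`, and a letter of `B` has below it only the `i - j` letters of `K` among those to the left
of `N`, where `j` is the length of `A`; so `B` avoids `P_{k-i+j}`. It may be empty only if `K` is
empty, in which case `S` is empty too; this gives the first summand of `g_{k,i}`. The avoidance of
`P_k` is never in danger to the left of `N`, since `i ≤ k - 2`. The left-to-right maxima of the whole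
are those of `K`, those of `A`, and `N`; similarly on the right. These decompositions are the set
equalities `splitsRight_eq` and `splitsLeft_eq`, with injective gluing maps, and `gf_prod` turns them
into the functional equations.

The solution is unique since each equation determines a coefficient of `x ^ (n + 1)` at level `k`
from coefficients of lower degree and from lower levels (`SystemAt.X_pow_dvd`).
-/

namespace FlatPOP

open Equiv PowerSeries

/-! ### Separable words -/

/-- The word `l` avoids `2413` and `3142`, in terms of its four-letter subsequences `a b c d`. -/
def SepList (l : List ℕ) : Prop :=
  ∀ a b c d, [a, b, c, d].Sublist l →
    ¬ (c < a ∧ a < d ∧ d < b) ∧ ¬ (b < d ∧ d < a ∧ a < c)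

/-- Reading the word `R` after the word `P`, no letter of `R` has `k - 1` or more smaller letters
before it, the letters of `P` included. For `P = []` this is avoidance of `P_k` (`k ≥ 1`). -/
def AvoidFrom (k : ℕ) : List ℕ → List ℕ → Prop
  | _, [] => True
  | P, x :: R => P.countP (· < x) + 1 < k ∧ AvoidFrom k (P ++ [x]) R

/-- The number of right-to-left maxima of a word. -/
def rmaxList : List ℕ → ℕ
  | [] => 0
  | x :: l => (if ∀ y ∈ l, y < x then 1 else 0) + rmaxList l

/-- The number of left-to-right maxima of a word. -/
def lmaxList (l : List ℕ) : ℕ := rmaxList l.reverse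

theorem SepList.sublist {l l' : List ℕ} (h : SepList l) (hl : l'.Sublist l) : SepList l' :=
  fun a b c d hs => h a b c d (hs.trans hl)

theorem sepList_nil : SepList [] := by
  intro a b c d h; simp at h

theorem sepList_singleton (x : ℕ) : SepList [x] := by
  intro a b c d h; have := h.length_le; simp at this

theorem sepList_map {f : ℕ → ℕ} (hf : StrictMono f) (l : List ℕ) :
    SepList (l.map f) ↔ SepList l := by
  constructor
  · intro h a b c d hs
    have := h _ _ _ _ (hs.map f)
    simpa only [hf.lt_iff_lt] using this
  · intro h a b c d hs
    obtain ⟨l', hl', e⟩ := List.sublist_map_iff.1 hs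
    match l', hl', e with
    | [a', b', c', d'], hl', e =>
      simp only [List.map_cons, List.map_nil, List.cons.injEq, and_true] at e
      obtain ⟨rfl, rfl, rfl, rfl⟩ := e
      simpa only [hf.lt_iff_lt] using h _ _ _ _ hl'

theorem four_sublist_append {a b c d : ℕ} {l₁ l₂ : List ℕ}
    (h : [a, b, c, d].Sublist (l₁ ++ l₂)) :
    [a, b, c, d].Sublist l₂ ∨ ([a].Sublist l₁ ∧ [b, c, d].Sublist l₂) ∨
    ([a, b].Sublist l₁ ∧ [c, d].Sublist l₂) ∨
    ([a, b, c].Sublist l₁ ∧ [d].Sublist l₂) ∨ [a, b, c, d].Sublist l₁ := by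
  obtain ⟨s, t, e, hs, ht⟩ := List.sublist_append_iff.1 h
  match s, hs, e with
  | [], hs, e => rw [List.nil_append] at e; subst e; exact Or.inl ht
  | [_], hs, e => simp at e; obtain ⟨rfl, rfl⟩ := e; tauto
  | [_, _], hs, e => simp at e; obtain ⟨rfl, rfl, rfl⟩ := e; tauto
  | [_, _, _], hs, e => simp at e; obtain ⟨rfl, rfl, rfl, rfl⟩ := e; tauto
  | [_, _, _, _], hs, e => simp at e; obtain ⟨rfl, rfl, rfl, rfl, rfl⟩ := e; tauto
  | _ :: _ :: _ :: _ :: _ :: _, hs, e => simp at e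

theorem sepList_append_of_lt {A B : List ℕ} (h : ∀ x ∈ A, ∀ y ∈ B, x < y) :
    SepList (A ++ B) ↔ SepList A ∧ SepList B := by
  refine ⟨fun h => ⟨h.sublist (List.sublist_append_left _ _),
    h.sublist (List.sublist_append_right _ _)⟩, ?_⟩
  rintro ⟨hA, hB⟩ a b c d hs
  rcases four_sublist_append hs with hs | ⟨h1, h2⟩ | ⟨h1, h2⟩ | ⟨h1, h2⟩ | hs
  · exact hB _ _ _ _ hs
  · have := h a (h1.subset (by simp))
    have h3 := this b (h2.subset (by simp))
    have h4 := this c (h2.subset (by simp))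
    have h5 := this d (h2.subset (by simp))
    omega
  · have h3 := h a (h1.subset (by simp)) c (h2.subset (by simp))
    have h4 := h b (h1.subset (by simp)) d (h2.subset (by simp))
    have h5 := h a (h1.subset (by simp)) d (h2.subset (by simp))
    omega
  · have h3 := h a (h1.subset (by simp)) d (h2.subset (by simp))
    have h4 := h b (h1.subset (by simp)) d (h2.subset (by simp))
    have h5 := h c (h1.subset (by simp)) d (h2.subset (by simp))
    omega
  · exact hA _ _ _ _ hs

theorem sepList_append_of_gt {A B : List ℕ} (h : ∀ x ∈ A, ∀ y ∈ B, y < x) :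
    SepList (A ++ B) ↔ SepList A ∧ SepList B := by
  refine ⟨fun h => ⟨h.sublist (List.sublist_append_left _ _),
    h.sublist (List.sublist_append_right _ _)⟩, ?_⟩
  rintro ⟨hA, hB⟩ a b c d hs
  rcases four_sublist_append hs with hs | ⟨h1, h2⟩ | ⟨h1, h2⟩ | ⟨h1, h2⟩ | hs
  · exact hB _ _ _ _ hs
  · have := h a (h1.subset (by simp))
    have h3 := this b (h2.subset (by simp))
    have h4 := this c (h2.subset (by simp))
    have h5 := this d (h2.subset (by simp))
    omega
  · have h3 := h a (h1.subset (by simp)) c (h2.subset (by simp))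
    have h4 := h b (h1.subset (by simp)) d (h2.subset (by simp))
    have h5 := h a (h1.subset (by simp)) d (h2.subset (by simp))
    omega
  · have h3 := h a (h1.subset (by simp)) d (h2.subset (by simp))
    have h4 := h b (h1.subset (by simp)) d (h2.subset (by simp))
    have h5 := h c (h1.subset (by simp)) d (h2.subset (by simp))
    omega
  · exact hA _ _ _ _ hs

/-- No two or three consecutive letters of `2413` or `3142` are its largest ones. So an occurrence
in the inflated word lies inside `M`, or it uses at most one letter of `M`, for which `m` can be
substituted. -/
theorem SepList.inflate {L M R : List ℕ} {m : ℕ} (h : SepList (L ++ m :: R)) (hM : SepList M)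
    (hL : ∀ x ∈ L, x < m ∧ ∀ y ∈ M, x < y) (hR : ∀ x ∈ R, x < m ∧ ∀ y ∈ M, x < y) :
    SepList (L ++ (M ++ R)) := by
  intro a b c d hs
  obtain ⟨s, t', e, hsL, ht'⟩ := List.sublist_append_iff.1 hs
  obtain ⟨t, r, rfl, htM, hrR⟩ := List.sublist_append_iff.1 ht'
  have hs1 : ∀ x ∈ s, x < m ∧ ∀ y ∈ t, x < y := fun x hx =>
    ⟨(hL x (hsL.subset hx)).1, fun y hy => (hL x (hsL.subset hx)).2 y (htM.subset hy)⟩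
  have hr1 : ∀ x ∈ r, x < m ∧ ∀ y ∈ t, x < y := fun x hx =>
    ⟨(hR x (hrR.subset hx)).1, fun y hy => (hR x (hrR.subset hx)).2 y (htM.subset hy)⟩
  match t, htM, e, hs1, hr1 with
  | [], htM, e, hs1, hr1 =>
    refine h a b c d ?_
    rw [e]
    exact hsL.append (hrR.trans (List.sublist_cons_self _ _))
  | [y], htM, e, hs1, hr1 =>
    have h' : (s ++ m :: r).Sublist (L ++ m :: R) := hsL.append (hrR.cons_cons m)
    match s, e, hs1, h' with
    | [], e, hs1, h' =>
      simp only [List.nil_append, List.singleton_append, List.cons.injEq] at e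
      obtain ⟨rfl, rfl⟩ := e
      simp only [List.forall_mem_cons] at hr1
      have := h _ _ _ _ h'
      grind
    | [_], e, hs1, h' =>
      simp only [List.nil_append, List.cons_append, List.cons.injEq] at e
      obtain ⟨rfl, rfl, rfl⟩ := e
      have := h _ _ _ _ h'
      grind
    | [_, _], e, hs1, h' =>
      simp only [List.nil_append, List.cons_append, List.cons.injEq] at e
      obtain ⟨rfl, rfl, rfl, rfl⟩ := e
      have := h _ _ _ _ h'
      grind
    | [_, _, _], e, hs1, h' =>
      simp only [List.nil_append, List.cons_append, List.cons.injEq] at e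
      obtain ⟨rfl, rfl, rfl, rfl, rfl⟩ := e
      have := h _ _ _ _ h'
      grind
    | _ :: _ :: _ :: _ :: _, e, _, _ => simp at e
  | [_, _], htM, e, hs1, hr1 =>
    match s, e, hs1 with
    | [], e, hs1 => simp at e; grind
    | [_], e, hs1 => simp at e; grind
    | [_, _], e, hs1 => simp at e; grind
    | _ :: _ :: _ :: _, e, hs1 =>
      have := congrArg List.length e
      simp at this
      omega
  | [_, _, _], htM, e, hs1, hr1 =>
    match s, e, hs1 with
    | [], e, hs1 => simp at e; grind
    | [_], e, hs1 => simp at e; grind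
    | _ :: _ :: _, e, hs1 =>
      have := congrArg List.length e
      simp at this
      omega
  | [_, _, _, _], htM, e, hs1, hr1 =>
    match s, e with
    | [], e =>
      simp at e
      obtain ⟨rfl, rfl, rfl, rfl, rfl⟩ := e
      exact hM _ _ _ _ htM
    | _ :: _, e =>
      have := congrArg List.length e
      simp at this
      omega
  | _ :: _ :: _ :: _ :: _ :: _, htM, e, hs1, hr1 =>
    have := congrArg List.length e
    simp at this
    omega

/-- The patterns `2413` and `3142` are simple, so replacing the largest letter `m` of a word by a
block `M` of letters that are all larger than the rest yields a word avoiding both patterns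
exactly if the original word and the block avoid them. -/
theorem sepList_inflate_iff {L M R : List ℕ} {m : ℕ} (hM : M ≠ [])
    (hL : ∀ x ∈ L, x < m ∧ ∀ y ∈ M, x < y) (hR : ∀ x ∈ R, x < m ∧ ∀ y ∈ M, x < y) :
    SepList (L ++ (M ++ R)) ↔ SepList (L ++ m :: R) ∧ SepList M := by
  refine ⟨fun h => ⟨?_, h.sublist ?_⟩, fun h => h.1.inflate h.2 hL hR⟩
  · obtain ⟨y, hy⟩ := List.exists_mem_of_ne_nil M hM
    have h' : SepList (L ++ y :: R) := h.sublist <| (List.Sublist.refl L).append <|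
      (List.singleton_sublist.2 hy).append (List.Sublist.refl R)
    refine SepList.inflate (M := [m]) h' (sepList_singleton m) ?_ ?_
    · exact fun x hx => ⟨(hL x hx).2 y hy, by simpa using (hL x hx).1⟩
    · exact fun x hx => ⟨(hR x hx).2 y hy, by simpa using (hR x hx).1⟩
  · exact (List.sublist_append_left M R).trans (List.sublist_append_right _ _)

/-! ### Avoiding the flat pattern, for words -/

theorem avoidFrom_append {k : ℕ} (P R S : List ℕ) :
    AvoidFrom k P (R ++ S) ↔ AvoidFrom k P R ∧ AvoidFrom k (P ++ R) S := by
  induction R generalizing P with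
  | nil => simp [AvoidFrom]
  | cons x R ih => simp [AvoidFrom, ih, and_assoc]

/-- Only the number of smaller letters in the prefix matters, and a change of it can be
compensated by changing `k`. -/
theorem avoidFrom_congr {k k' : ℕ} {P P' R : List ℕ}
    (h : ∀ x ∈ R, P.countP (· < x) + k' = P'.countP (· < x) + k) :
    AvoidFrom k P R ↔ AvoidFrom k' P' R := by
  induction R generalizing P P' with
  | nil => simp [AvoidFrom]
  | cons x R ih =>
    have h0 := h x (by simp)
    simp only [AvoidFrom]
    rw [ih (P := P ++ [x]) (P' := P' ++ [x])]
    · refine and_congr_left fun _ => ?_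
      omega
    · intro y hy
      have := h y (by simp [hy])
      simp only [List.countP_append]
      omega

theorem avoidFrom_map {k : ℕ} {f : ℕ → ℕ} (hf : StrictMono f) (P R : List ℕ) :
    AvoidFrom k (P.map f) (R.map f) ↔ AvoidFrom k P R := by
  induction R generalizing P with
  | nil => simp [AvoidFrom]
  | cons x R ih =>
    have := ih (P ++ [x])
    simp only [List.map_append, List.map_cons, List.map_nil] at this
    simp [AvoidFrom, this, List.countP_map, Function.comp_def, hf.lt_iff_lt]

theorem avoidFrom_of_length {k : ℕ} {P R : List ℕ} (h : P.length + R.length < k) :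
    AvoidFrom k P R := by
  induction R generalizing P with
  | nil => simp [AvoidFrom]
  | cons x R ih =>
    have : P.countP (· < x) ≤ P.length := List.countP_le_length
    simp only [List.length_cons] at h
    exact ⟨by omega, ih (by simp; omega)⟩

theorem avoidFrom_iff {k : ℕ} {P R : List ℕ} :
    AvoidFrom k P R ↔ ∀ R₁ x R₂, R = R₁ ++ x :: R₂ → (P ++ R₁).countP (· < x) + 1 < k := by
  induction R generalizing P with
  | nil => simp [AvoidFrom]
  | cons x R ih =>
    simp only [AvoidFrom, ih]
    constructor
    · rintro ⟨h1, h2⟩ R₁ y R₂ e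
      cases R₁ with
      | nil => simp at e; obtain ⟨rfl, rfl⟩ := e; simpa using h1
      | cons z R₁ =>
        simp at e; obtain ⟨rfl, rfl⟩ := e
        simpa using h2 R₁ y R₂ rfl
    · intro h
      refine ⟨by simpa using h [] x R rfl, ?_⟩
      rintro R₁ y R₂ rfl
      simpa using h (x :: R₁) y R₂ rfl

/-! ### Maxima of words -/

theorem rmaxList_map {f : ℕ → ℕ} (hf : StrictMono f) (l : List ℕ) :
    rmaxList (l.map f) = rmaxList l := by
  induction l with
  | nil => rfl
  | cons x l ih => simp [rmaxList, ih, hf.lt_iff_lt]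

theorem rmaxList_append_of_gt {A B : List ℕ} (h : ∀ x ∈ A, ∀ y ∈ B, y < x) :
    rmaxList (A ++ B) = rmaxList A + rmaxList B := by
  induction A with
  | nil => simp [rmaxList]
  | cons x A ih =>
    have : (∀ y ∈ A ++ B, y < x) ↔ ∀ y ∈ A, y < x := by
      simp only [List.mem_append]
      exact ⟨fun H y hy => H y (Or.inl hy), fun H y hy => hy.elim (H y) (h x (by simp) y)⟩
    rw [List.cons_append, rmaxList, rmaxList, ih fun y hy => h y (by simp [hy]), if_congr this rfl rfl,
      add_assoc]

theorem rmaxList_append_cons {L R : List ℕ} {n : ℕ} (hL : ∀ x ∈ L, x < n) (hR : ∀ x ∈ R, x < n) :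
    rmaxList (L ++ n :: R) = rmaxList R + 1 := by
  induction L with
  | nil => simp [rmaxList, add_comm]; exact hR
  | cons x L ih =>
    rw [List.cons_append, rmaxList, ih fun y hy => hL y (by simp [hy]), if_neg, zero_add]
    intro H
    have := H n (by simp)
    have := hL x (by simp)
    omega

theorem lmaxList_map {f : ℕ → ℕ} (hf : StrictMono f) (l : List ℕ) :
    lmaxList (l.map f) = lmaxList l := by
  rw [lmaxList, ← List.map_reverse, rmaxList_map hf, lmaxList]

theorem lmaxList_append_of_lt {A B : List ℕ} (h : ∀ x ∈ A, ∀ y ∈ B, x < y) :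
    lmaxList (A ++ B) = lmaxList A + lmaxList B := by
  rw [lmaxList, List.reverse_append, rmaxList_append_of_gt, add_comm, lmaxList, lmaxList]
  intro x hx y hy
  exact h y (by simpa using hy) x (by simpa using hx)

theorem lmaxList_append_cons {L R : List ℕ} {n : ℕ} (hL : ∀ x ∈ L, x < n) (hR : ∀ x ∈ R, x < n) :
    lmaxList (L ++ n :: R) = lmaxList L + 1 := by
  rw [lmaxList, List.reverse_append, List.reverse_cons, List.append_assoc, List.singleton_append,
    rmaxList_append_cons (by simpa using hR) (by simpa using hL), lmaxList]

/-! ### Permutation words -/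

/-- The word `l` is the one-line notation of a permutation of `0, …, l.length - 1`. -/
def IsPerm (l : List ℕ) : Prop := l.Perm (List.range l.length)

theorem IsPerm.lt {l : List ℕ} (h : IsPerm l) {x : ℕ} (hx : x ∈ l) : x < l.length := by
  simpa using h.subset hx

theorem IsPerm.nodup {l : List ℕ} (h : IsPerm l) : l.Nodup := h.nodup_iff.2 List.nodup_range

theorem IsPerm.perm {l l' : List ℕ} (h : IsPerm l) (e : l.Perm l') : IsPerm l' := by
  rw [IsPerm, ← e.length_eq]; exact e.symm.trans h

theorem IsPerm.append_map {P Q : List ℕ} (hP : IsPerm P) (hQ : IsPerm Q) :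
    IsPerm (P ++ Q.map (P.length + ·)) := by
  rw [IsPerm, List.length_append, List.length_map, List.range_add]
  exact hP.append (hQ.map _)

/-- A permutation word cut into a part with the small letters and a part with the large ones is
a permutation word followed by a shifted permutation word. -/
theorem IsPerm.of_append_lt {P Q : List ℕ} (h : IsPerm (P ++ Q)) (hlt : ∀ x ∈ P, ∀ y ∈ Q, x < y) :
    IsPerm P ∧ ∃ Q', IsPerm Q' ∧ Q = Q'.map (P.length + ·) := by
  -- Sorting the parts separately sorts the whole word.
  have key : P.mergeSort ++ Q.mergeSort = List.range P.length ++ (List.range Q.length).map (P.length + ·) := by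
    rw [← List.range_add, ← List.length_append]
    refine List.Perm.eq_of_pairwise (le := fun a b => a ≤ b) ?_ ?_ ?_ ?_
    · intro a b _ _ h1 h2; exact le_antisymm h1 h2
    · rw [List.pairwise_append]
      refine ⟨?_, ?_, ?_⟩
      · exact P.pairwise_mergeSort' (· ≤ ·)
      · exact Q.pairwise_mergeSort' (· ≤ ·)
      · intro a ha b hb
        exact (hlt a (by simpa using ha) b (by simpa using hb)).le
    · exact List.pairwise_le_range
    · exact ((List.mergeSort_perm _ _).append (List.mergeSort_perm _ _)).trans h
  obtain ⟨e1, e2⟩ := List.append_inj key (by simp)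
  have hQ : Q.Perm ((List.range Q.length).map (P.length + ·)) :=
    e2 ▸ (List.mergeSort_perm Q _).symm
  have hP : P.Perm (List.range P.length) := e1 ▸ (List.mergeSort_perm P _).symm
  refine ⟨hP, Q.map (· - P.length), ?_, ?_⟩
  · have := hQ.map (· - P.length)
    simpa [IsPerm, List.map_map, Function.comp_def] using this
  · rw [List.map_map]
    symm
    refine (List.map_congr_left fun x hx => ?_).trans (List.map_id _)
    have := hQ.subset hx
    simp only [List.mem_map, List.mem_range] at this
    obtain ⟨y, -, rfl⟩ := this
    simp

theorem finite_isPerm (n : ℕ) : {l : List ℕ | IsPerm l ∧ l.length = n}.Finite := by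
  refine ((List.range n).permutations.toFinset.finite_toSet).subset ?_
  rintro l ⟨h, rfl⟩
  simpa using (show l.Perm _ from h)

/-! ### Generating functions of graded sets -/

/-- The generating function `∑ w a * x ^ size a` over `a ∈ S`. It is meaningful if each degree has
finitely many elements (`FiniteFibers`); `∑ᶠ` reads `0` when its support is infinite. -/
noncomputable def gf {α : Type*} (S : Set α) (size : α → ℕ) (w : α → Poly) : Series :=
  PowerSeries.mk fun n => ∑ᶠ a ∈ {a | a ∈ S ∧ size a = n}, w a

/-- The set `S` has finitely many elements of each size. -/
def FiniteFibers {α : Type*} (S : Set α) (size : α → ℕ) : Prop :=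
  ∀ n, {a | a ∈ S ∧ size a = n}.Finite

theorem coeff_gf {α : Type*} (S : Set α) (size : α → ℕ) (w : α → Poly) (n : ℕ) :
    coeff n (gf S size w) = ∑ᶠ a ∈ {a | a ∈ S ∧ size a = n}, w a := by
  simp [gf]

theorem FiniteFibers.mono {α : Type*} {S T : Set α} {size : α → ℕ} (h : FiniteFibers T size)
    (hST : S ⊆ T) : FiniteFibers S size :=
  fun n => (h n).subset fun _ ha => ⟨hST ha.1, ha.2⟩

theorem FiniteFibers.prod {α β : Type*} {S : Set α} {T : Set β} {s : α → ℕ} {t : β → ℕ}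
    (hS : FiniteFibers S s) (hT : FiniteFibers T t) :
    FiniteFibers (S ×ˢ T) fun p => s p.1 + t p.2 := by
  intro n
  have h1 := (Set.finite_Iic n).biUnion fun i _ => hS i
  have h2 := (Set.finite_Iic n).biUnion fun i _ => hT i
  refine (h1.prod h2).subset ?_
  rintro ⟨a, b⟩ ⟨⟨ha, hb⟩, rfl⟩
  simp only [Set.mem_prod, Set.mem_iUnion]
  exact ⟨⟨s a, by simp, ha, rfl⟩, ⟨t b, by simp, hb, rfl⟩⟩

theorem gf_congr {α : Type*} {S : Set α} {s s' : α → ℕ} {w w' : α → Poly}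
    (hs : ∀ a ∈ S, s a = s' a) (hw : ∀ a ∈ S, w a = w' a) : gf S s w = gf S s' w' := by
  ext1 n
  rw [coeff_gf, coeff_gf]
  have : {a | a ∈ S ∧ s a = n} = {a | a ∈ S ∧ s' a = n} := by
    ext a; exact and_congr_right fun ha => by rw [hs a ha]
  rw [this]
  exact finsum_mem_congr rfl fun a ha => hw a ha.1

theorem gf_empty {α : Type*} (s : α → ℕ) (w : α → Poly) : gf (∅ : Set α) s w = 0 := by
  ext1 n
  rw [coeff_gf]
  simp

theorem gf_image {α β : Type*} {S : Set α} {e : α → β} (he : Set.InjOn e S) (t : β → ℕ)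
    (w : β → Poly) : gf (e '' S) t w = gf S (t ∘ e) (w ∘ e) := by
  ext1 n
  rw [coeff_gf, coeff_gf]
  have : {b | b ∈ e '' S ∧ t b = n} = e '' {a | a ∈ S ∧ (t ∘ e) a = n} := by
    ext b
    constructor
    · rintro ⟨⟨a, ha, rfl⟩, h⟩
      exact ⟨a, ⟨ha, h⟩, rfl⟩
    · rintro ⟨a, ⟨ha, h⟩, rfl⟩
      exact ⟨⟨a, ha, rfl⟩, h⟩
  rw [this, finsum_mem_image (he.mono fun a ha => ha.1)]
  rfl

theorem gf_union {α : Type*} {S T : Set α} {s : α → ℕ} {w : α → Poly} (hS : FiniteFibers S s)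
    (hT : FiniteFibers T s) (hd : Disjoint S T) : gf (S ∪ T) s w = gf S s w + gf T s w := by
  ext1 n
  rw [map_add, coeff_gf, coeff_gf, coeff_gf]
  have : {a | a ∈ S ∪ T ∧ s a = n} = {a | a ∈ S ∧ s a = n} ∪ {a | a ∈ T ∧ s a = n} := by
    ext a; simp [or_and_right]
  rw [this]
  exact finsum_mem_union (hd.mono (fun a ha => ha.1) fun a ha => ha.1) (hS n) (hT n)

theorem gf_biUnion {ι α : Type*} {I : Finset ι} {S : ι → Set α} {s : α → ℕ} {w : α → Poly}
    (hS : ∀ i ∈ I, FiniteFibers (S i) s)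
    (hd : ∀ i ∈ I, ∀ j ∈ I, i ≠ j → Disjoint (S i) (S j)) :
    gf (⋃ i ∈ I, S i) s w = ∑ i ∈ I, gf (S i) s w := by
  ext1 n
  rw [map_sum, coeff_gf]
  simp only [coeff_gf]
  have : {a | a ∈ (⋃ i ∈ I, S i) ∧ s a = n} = ⋃ i ∈ (I : Set ι), {a | a ∈ S i ∧ s a = n} := by
    ext a
    simp only [Set.mem_ofPred_eq, Set.mem_iUnion, Finset.mem_coe, exists_prop]
    tauto
  rw [this, finsum_mem_biUnion _ I.finite_toSet fun i hi => hS i hi n, finsum_mem_coe_finset]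
  intro i hi j hj hij
  exact (hd i hi j hj hij).mono (fun a ha => ha.1) fun a ha => ha.1

theorem gf_prod {α β : Type*} {S : Set α} {T : Set β} {s : α → ℕ} {t : β → ℕ}
    (hS : FiniteFibers S s) (hT : FiniteFibers T t) (w : α → Poly) (z : β → Poly) :
    gf (S ×ˢ T) (fun p => s p.1 + t p.2) (fun p => w p.1 * z p.2) = gf S s w * gf T t z := by
  ext1 n
  rw [coeff_mul, coeff_gf]
  have : {p | p ∈ S ×ˢ T ∧ s p.1 + t p.2 = n} = ⋃ i ∈ (Finset.HasAntidiagonal.antidiagonal n : Set (ℕ × ℕ)),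
      {a | a ∈ S ∧ s a = i.1} ×ˢ {b | b ∈ T ∧ t b = i.2} := by
    ext ⟨a, b⟩
    simp only [Set.mem_ofPred_eq, Set.mem_iUnion, Set.mem_prod, Finset.mem_coe,
      Finset.HasAntidiagonal.mem_antidiagonal, exists_prop]
    constructor
    · rintro ⟨⟨ha, hb⟩, h⟩
      exact ⟨(s a, t b), h, ⟨ha, rfl⟩, ⟨hb, rfl⟩⟩
    · rintro ⟨i, hi, ⟨ha, e1⟩, ⟨hb, e2⟩⟩
      exact ⟨⟨ha, hb⟩, by rw [e1, e2, hi]⟩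
  rw [this, finsum_mem_biUnion _ (Finset.finite_toSet _) fun i _ => (hS _).prod (hT _),
    finsum_mem_coe_finset]
  · refine Finset.sum_congr rfl fun i _ => ?_
    rw [coeff_gf, coeff_gf]
    obtain ⟨A, hA⟩ := (hS i.1).exists_finset_coe
    obtain ⟨B, hB⟩ := (hT i.2).exists_finset_coe
    rw [← hA, ← hB, ← Finset.coe_product, finsum_mem_coe_finset, finsum_mem_coe_finset,
      finsum_mem_coe_finset, Finset.sum_mul_sum, Finset.sum_product]
  · intro i _ j _ hij
    refine Set.disjoint_left.2 ?_
    rintro ⟨a, b⟩ ⟨h1, h2⟩ ⟨h3, h4⟩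
    exact hij (Prod.ext (h1.2.symm.trans h3.2) (h2.2.symm.trans h4.2))

theorem gf_size_add {α : Type*} {S : Set α} {s : α → ℕ} (hS : FiniteFibers S s) (w : α → Poly)
    (c : ℕ) (p : Poly) :
    gf S (fun a => s a + c) (fun a => p * w a) = C p * X ^ c * gf S s w := by
  ext1 n
  rw [mul_assoc, coeff_C_mul, coeff_X_pow_mul', coeff_gf]
  split_ifs with h
  · rw [coeff_gf]
    have : {a | a ∈ S ∧ s a + c = n} = {a | a ∈ S ∧ s a = n - c} := by
      ext a; exact and_congr_right fun _ => by omega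
    rw [this]
    obtain ⟨A, hA⟩ := (hS (n - c)).exists_finset_coe
    rw [← hA, finsum_mem_coe_finset, finsum_mem_coe_finset, Finset.mul_sum]
  · have : {a | a ∈ S ∧ s a + c = n} = ∅ := by
      ext a; simp only [Set.mem_ofPred_eq, Set.mem_empty_iff_false, iff_false]; omega
    rw [this, finsum_mem_empty, mul_zero]

theorem map_gf {α : Type*} {S : Set α} {s : α → ℕ} (hS : FiniteFibers S s) (w : α → Poly)
    (φ : Poly →+* Poly) : PowerSeries.map φ (gf S s w) = gf S s fun a => φ (w a) := by
  ext1 n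
  rw [coeff_map, coeff_gf, coeff_gf]
  obtain ⟨A, hA⟩ := (hS n).exists_finset_coe
  rw [← hA, finsum_mem_coe_finset, finsum_mem_coe_finset, map_sum]

theorem gf_of_const_size {α : Type*} {S : Set α} {s : α → ℕ} (w : α → Poly) {n : ℕ}
    (h : ∀ a ∈ S, s a = n) : gf S s w = C (∑ᶠ a ∈ S, w a) * X ^ n := by
  ext1 m
  rw [coeff_gf, coeff_C_mul, coeff_X_pow]
  split_ifs with hm
  · have : {a | a ∈ S ∧ s a = m} = S := by
      ext a; exact ⟨fun h => h.1, fun ha => ⟨ha, hm ▸ h a ha⟩⟩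
    rw [this, mul_one]
  · have : {a | a ∈ S ∧ s a = m} = ∅ := by
      ext a
      simp only [Set.mem_ofPred_eq, Set.mem_empty_iff_false, iff_false, not_and]
      exact fun ha e => hm (e.symm.trans (h a ha))
    rw [this, finsum_mem_empty, mul_zero]

/-! ### One-line notation -/

/-- One-line notation, with letters `0, …, n - 1`. -/
def oneLine {n : ℕ} (π : Perm (Fin n)) : List ℕ := List.ofFn fun i => (π i : ℕ)

theorem length_oneLine {n : ℕ} (π : Perm (Fin n)) : (oneLine π).length = n := by
  simp [oneLine]

theorem isPerm_oneLine {n : ℕ} (π : Perm (Fin n)) : IsPerm (oneLine π) := by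
  rw [IsPerm, length_oneLine, List.perm_ext_iff_of_nodup _ List.nodup_range]
  · intro a
    simp only [oneLine, List.mem_ofFn, List.mem_range]
    constructor
    · rintro ⟨i, rfl⟩; exact (π i).2
    · intro h; exact ⟨π.symm ⟨a, h⟩, by simp⟩
  · exact List.nodup_ofFn.2 (Fin.val_injective.comp π.injective)

theorem oneLine_injective {n : ℕ} : Function.Injective (oneLine : Perm (Fin n) → List ℕ) := by
  intro π σ h
  have := List.ofFn_injective h
  ext i
  exact congrFun this i

theorem exists_oneLine_eq {l : List ℕ} (h : IsPerm l) {n : ℕ} (hn : l.length = n) :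
    ∃ π : Perm (Fin n), oneLine π = l := by
  subst hn
  let f : Fin l.length → Fin l.length := fun i => ⟨l.get i, h.lt (l.get_mem i)⟩
  have hf : Function.Injective f := by
    intro i j hij
    exact h.nodup.injective_get (congrArg Fin.val hij)
  refine ⟨Equiv.ofBijective f (Finite.injective_iff_bijective.1 hf), ?_⟩
  simp [oneLine, f]

theorem sublist_ofFn_iff {n : ℕ} {f : Fin n → ℕ} {s : List ℕ} :
    s.Sublist (List.ofFn f) ↔ ∃ e : Fin s.length ↪o Fin n, ∀ i, s.get i = f (e i) := by
  rw [List.sublist_iff_exists_fin_orderEmbedding_get_eq]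
  constructor
  · rintro ⟨e, he⟩
    refine ⟨e.trans (Fin.castOrderIso (List.length_ofFn)).toOrderEmbedding, fun i => ?_⟩
    rw [he i]
    simp only [List.get_eq_getElem, List.getElem_ofFn]
    rfl
  · rintro ⟨e, he⟩
    refine ⟨e.trans (Fin.castOrderIso (List.length_ofFn (f := f)).symm).toOrderEmbedding,
      fun i => ?_⟩
    rw [he i]
    simp

theorem containsPattern_iff {n : ℕ} (τ : Fin 4 → ℕ) (π : Perm (Fin n)) :
    ContainsPattern τ π ↔ ∃ a b c d, [a, b, c, d].Sublist (oneLine π) ∧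
      ∀ i j : Fin 4, ![a, b, c, d] i < ![a, b, c, d] j ↔ τ i < τ j := by
  constructor
  · rintro ⟨e, he⟩
    refine ⟨π (e 0), π (e 1), π (e 2), π (e 3), sublist_ofFn_iff.2 ⟨e, ?_⟩, ?_⟩
    · intro i; fin_cases i <;> rfl
    · intro i j
      rw [← he i j, Fin.lt_def]
      fin_cases i <;> fin_cases j <;> rfl
  · rintro ⟨a, b, c, d, hs, h⟩
    obtain ⟨e, he⟩ := sublist_ofFn_iff.1 hs
    have he' : ∀ i : Fin 4, (π (e i) : ℕ) = ![a, b, c, d] i := by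
      intro i; rw [← he i]; fin_cases i <;> rfl
    refine ⟨e, fun i j => ?_⟩
    rw [← h i j, Fin.lt_def, he' i, he' j]

theorem sepList_oneLine {n : ℕ} (π : Perm (Fin n)) : SepList (oneLine π) ↔ π ∈ separable n := by
  rw [separable, Set.mem_ofPred_eq, containsPattern_iff, containsPattern_iff]
  push Not
  constructor
  · intro h
    constructor
    · intro a b c d hs
      by_contra! H
      simp [Fin.forall_fin_succ] at H
      have := h a b c d hs
      omega
    · intro a b c d hs
      by_contra! H
      simp [Fin.forall_fin_succ] at H
      have := h a b c d hs
      omega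
  · rintro ⟨h1, h2⟩ a b c d hs
    constructor
    · rintro ⟨x1, x2, x3⟩
      obtain ⟨i, j, H⟩ := h1 a b c d hs
      fin_cases i <;> fin_cases j <;> simp at H <;> omega
    · rintro ⟨x1, x2, x3⟩
      obtain ⟨i, j, H⟩ := h2 a b c d hs
      fin_cases i <;> fin_cases j <;> simp at H <;> omega

theorem containsPOP_iff {k n : ℕ} (hk : 1 ≤ k) (π : Perm (Fin n)) :
    ContainsPOP (flatRel k) π ↔
      ∃ s x, (s ++ [x]).Sublist (oneLine π) ∧ s.length + 1 = k ∧ ∀ y ∈ s, y < x := by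
  obtain ⟨k, rfl⟩ : ∃ m, k = m + 1 := ⟨k - 1, by omega⟩
  constructor
  · rintro ⟨e, he⟩
    refine ⟨List.ofFn fun i : Fin k => (π (e i.castSucc) : ℕ), π (e (Fin.last k)), ?_, by simp, ?_⟩
    · rw [← List.concat_eq_append,
        ← List.ofFn_succ' (fun i : Fin (k + 1) => (π (e i) : ℕ)), oneLine, sublist_ofFn_iff]
      refine ⟨(Fin.castOrderIso List.length_ofFn).toOrderEmbedding.trans e, fun i => ?_⟩
      simp only [List.get_eq_getElem, List.getElem_ofFn]
      rfl
    · intro y hy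
      obtain ⟨i, rfl⟩ := List.mem_ofFn.1 hy
      exact he _ _ ⟨by simp, by simp⟩
  · rintro ⟨s, x, hs, hk, hx⟩
    obtain ⟨e, he⟩ := sublist_ofFn_iff.1 hs
    have hl : (s ++ [x]).length = k + 1 := by simpa using hk
    refine ⟨(Fin.castOrderIso hl.symm).toOrderEmbedding.trans e, ?_⟩
    rintro a b ⟨ha, hb⟩
    have h1 := he (Fin.cast hl.symm a)
    have h2 := he (Fin.cast hl.symm b)
    rw [Fin.lt_def]
    change ((π (e (Fin.cast hl.symm a)) : Fin n) : ℕ) < (π (e (Fin.cast hl.symm b)) : Fin n)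
    rw [← h1, ← h2]
    have ha' : (a : ℕ) < s.length := by omega
    have hb' : (b : ℕ) = s.length := by omega
    simp only [List.get_eq_getElem, Fin.val_cast, hb', List.getElem_append_left ha',
      List.getElem_concat_length]
    exact hx _ (List.getElem_mem ha')

theorem avoidFrom_oneLine {k n : ℕ} (hk : 1 ≤ k) (π : Perm (Fin n)) :
    AvoidFrom k [] (oneLine π) ↔ ¬ ContainsPOP (flatRel k) π := by
  rw [containsPOP_iff hk, avoidFrom_iff]
  constructor
  · rintro h ⟨s, x, hs, hl, hx⟩
    obtain ⟨r₁, r₂, e, h1, h2⟩ := List.append_sublist_iff.1 hs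
    obtain ⟨t₁, t₂, rfl⟩ := List.append_of_mem (List.singleton_sublist.1 h2)
    have := h (r₁ ++ t₁) x t₂ (by simp [e])
    have h3 : s.countP (· < x) ≤ (r₁ ++ t₁).countP (· < x) :=
      (h1.trans (List.sublist_append_left _ _)).countP_le
    rw [List.countP_eq_length.2 (by simpa using hx)] at h3
    simp only [List.nil_append] at this
    omega
  · intro h R₁ x R₂ e
    by_contra! H
    simp only [List.nil_append] at H
    refine h ⟨(R₁.filter (· < x)).take (k - 1), x, ?_, ?_, ?_⟩
    · rw [e]
      exact ((List.take_sublist _ _).trans List.filter_sublist).append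
        (List.singleton_sublist.2 (by simp))
    · rw [List.length_take, ← List.countP_eq_length_filter]
      omega
    · intro y hy
      simpa using List.of_mem_filter (List.mem_of_mem_take hy)

theorem ncard_rmax {n : ℕ} (f : Fin n → ℕ) :
    {i : Fin n | ∀ j, i < j → f j < f i}.ncard = rmaxList (List.ofFn f) := by
  induction n with
  | zero => simp [rmaxList, Set.eq_empty_of_isEmpty]
  | succ n ih =>
    rw [List.ofFn_succ, rmaxList, ← ih]
    set T : Set (Fin n) := {i | ∀ j, i < j → f j.succ < f i.succ}
    have hT : (Fin.succ '' T).ncard = T.ncard := Set.ncard_image_of_injective _ (Fin.succ_injective n)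
    simp only [List.forall_mem_ofFn_iff]
    split_ifs with h
    · have : {i : Fin (n + 1) | ∀ j, i < j → f j < f i} = insert 0 (Fin.succ '' T) := by
        ext i
        cases i using Fin.cases <;> simp [T, Fin.forall_fin_succ, h]
      rw [this, Set.ncard_insert_of_notMem (by simp), hT, add_comm]
    · have : {i : Fin (n + 1) | ∀ j, i < j → f j < f i} = Fin.succ '' T := by
        ext i
        cases i using Fin.cases <;> simp [T, Fin.forall_fin_succ]
        simpa using h
      rw [this, hT, zero_add]

theorem rmax_eq {n : ℕ} (π : Perm (Fin n)) : rmax π = rmaxList (oneLine π) :=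
  ncard_rmax fun i => (π i : ℕ)

theorem lmax_eq {n : ℕ} (π : Perm (Fin n)) : lmax π = lmaxList (oneLine π) := by
  have e : (oneLine π).reverse = List.ofFn fun i => (π i.rev : ℕ) := by
    apply List.ext_getElem
    · simp [oneLine]
    · intro i h1 h2
      simp only [oneLine, List.getElem_reverse, List.getElem_ofFn, List.length_ofFn]
      refine congrArg (fun t => (π t : ℕ)) (Fin.ext ?_)
      simp only [Fin.val_rev]
      omega
  rw [lmaxList, e, ← ncard_rmax, lmax, ← Set.ncard_image_of_injective _ Fin.rev_injective]
  congr 1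
  ext i
  simp only [Set.mem_image, Set.mem_ofPred_eq]
  constructor
  · rintro ⟨i, h, rfl⟩ j hj
    simpa using h j.rev (Fin.rev_lt_iff.1 hj)
  · intro h
    refine ⟨i.rev, fun j hj => ?_, by simp⟩
    simpa using h j.rev (Fin.lt_rev_iff.1 hj)

/-! ### Splitting a separable word at its largest letter -/

theorem exists_max_mem {L : List ℕ} (h : L ≠ []) : ∃ x ∈ L, ∀ y ∈ L, y ≤ x := by
  obtain ⟨x, hx, h⟩ := L.toFinset.exists_max_image id (by simpa using h)
  exact ⟨x, by simpa using hx, fun y hy => h y (by simpa using hy)⟩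

/-- If `p w` forces `p z` for every earlier `z`, the letters with `p` form an initial segment. -/
theorem exists_append_of_closed (p : ℕ → Prop) (R : List ℕ)
    (h : ∀ z w, [z, w].Sublist R → p w → p z) :
    ∃ B S, R = B ++ S ∧ (∀ y ∈ B, p y) ∧ ∀ y ∈ S, ¬ p y := by
  induction R with
  | nil => exact ⟨[], [], by simp⟩
  | cons z R ih =>
    by_cases hz : p z
    · obtain ⟨B, S, rfl, hB, hS⟩ := ih fun z w hs => h z w (hs.trans (List.sublist_cons_self _ _))
      exact ⟨z :: B, S, rfl, by simpa using ⟨hz, hB⟩, hS⟩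
    · refine ⟨[], z :: R, rfl, by simp, ?_⟩
      intro y hy hpy
      rcases List.mem_cons.1 hy with rfl | hy
      · exact hz hpy
      · exact hz (h z y ((List.singleton_sublist.2 hy).cons_cons z) hpy)

/-- For a letter `x` left of the maximum `N`, the letters right of `N` that exceed `x` precede the
ones below `x`: otherwise `x N z w` is an occurrence of `2413`. -/
theorem SepList.exists_right {L R : List ℕ} {N x : ℕ} (h : SepList (L ++ N :: R))
    (hN : ∀ y ∈ R, y < N) (hd : ∀ x ∈ L, ∀ y ∈ R, x ≠ y) (hx : x ∈ L) :
    ∃ B S, R = B ++ S ∧ (∀ y ∈ B, x < y) ∧ ∀ y ∈ S, y < x := by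
  obtain ⟨B, S, rfl, hB, hS⟩ := exists_append_of_closed (x < ·) R fun z w hs hw => by
    have h1 := h x N z w ((List.singleton_sublist.2 hx).append (hs.cons_cons N))
    have h2 := hN w (hs.subset (by simp))
    have h3 := hd x hx z (hs.subset (by simp))
    omega
  refine ⟨B, S, rfl, hB, fun y hy => ?_⟩
  have := hS y hy
  have := hd x hx y (by simp [hy])
  omega

/-- For a letter `y` right of the maximum `N`, the letters left of `N` that exceed `y` follow the
ones below `y`: otherwise `z w N y` is an occurrence of `3142`. -/
theorem SepList.exists_left {L R : List ℕ} {N y : ℕ} (h : SepList (L ++ N :: R))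
    (hN : ∀ x ∈ L, x < N) (hd : ∀ x ∈ L, ∀ y ∈ R, x ≠ y) (hy : y ∈ R) :
    ∃ K A, L = K ++ A ∧ (∀ x ∈ K, x < y) ∧ ∀ x ∈ A, y < x := by
  obtain ⟨K, A, rfl, hK, hA⟩ := exists_append_of_closed (· < y) L fun z w hs hw => by
    have h1 := h z w N y (hs.append ((List.singleton_sublist.2 hy).cons_cons N))
    have h2 := hN z (hs.subset (by simp))
    have h3 := hd z (hs.subset (by simp)) y hy
    omega
  refine ⟨K, A, rfl, hK, fun x hx => ?_⟩
  have := hA x hx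
  have := hd x (by simp [hx]) y hy
  omega

/-- If the second largest letter is to the right of the maximum `N`, then next to `N` there are a
block `B` of the letters above all of `L`, and a block `A` of the letters of `L` above the rest
of `R`. Removing both leaves a word of the same type. -/
theorem SepList.exists_blocks_of_right {L R : List ℕ} {N : ℕ} (h : SepList (L ++ N :: R))
    (hN : ∀ x ∈ L ++ R, x < N) (hd : ∀ x ∈ L, ∀ y ∈ R, x ≠ y) (hL : L ≠ [])
    (hLR : ∀ x ∈ L, ∃ y ∈ R, x < y) :
    ∃ K A B S, L = K ++ A ∧ R = B ++ S ∧ A ≠ [] ∧ B ≠ [] ∧ (∀ x ∈ A, ∀ y ∈ B, x < y) ∧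
      (∀ x ∈ K ++ S, ∀ y ∈ A ++ B, x < y) ∧ ∀ x ∈ K, ∃ y ∈ S, x < y := by
  obtain ⟨x₀, hx₀, hmax⟩ := exists_max_mem hL
  obtain ⟨B, S, rfl, hB, hS⟩ := h.exists_right (fun y hy => hN y (by simp [hy])) hd hx₀
  have hB0 : B ≠ [] := by
    rintro rfl
    obtain ⟨y, hy, hxy⟩ := hLR x₀ hx₀
    exact (hS y (by simpa using hy)).asymm hxy
  rcases eq_or_ne S [] with rfl | hS0
  · refine ⟨[], L, B, [], rfl, rfl, hL, hB0, fun x hx y hy => (hmax x hx).trans_lt (hB y hy),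
      by simp, by simp⟩
  · obtain ⟨y₀, hy₀, hmax'⟩ := exists_max_mem hS0
    -- The rest of `R` is nonempty; its maximum cuts `L`.
    obtain ⟨K, A, rfl, hK, hA⟩ := h.exists_left (fun y hy => hN y (by simp [hy])) hd
      (y := y₀) (by simp [hy₀])
    refine ⟨K, A, B, S, rfl, rfl, ?_, hB0, ?_, ?_, fun x hx => ⟨y₀, hy₀, hK x hx⟩⟩
    · rintro rfl
      have h1 := hK x₀ (by simpa using hx₀)
      have h2 := hS y₀ hy₀
      omega
    · exact fun x hx y hy => (hmax x (by simp [hx])).trans_lt (hB y hy)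
    · intro x hx y hy
      have hx' : x ≤ y₀ := by
        rcases List.mem_append.1 hx with hx | hx
        · exact (hK x hx).le
        · exact hmax' x hx
      rcases List.mem_append.1 hy with hy | hy
      · exact hx'.trans_lt (hA y hy)
      · have := hS y₀ hy₀
        have := hB y hy
        omega

/-- If the second largest letter is to the left of the maximum `N`, then next to `N` there are a
block `A` of the letters above all of `R`, and a block `B` of the letters of `R` above the rest
of `L`. If the rest `K` of `L` is empty, then `B` is all of `R`; otherwise `B` is nonempty and
removing both blocks leaves a word of the same type. -/
theorem SepList.exists_blocks_of_left {L R : List ℕ} {N : ℕ} (h : SepList (L ++ N :: R))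
    (hN : ∀ x ∈ L ++ R, x < N) (hd : ∀ x ∈ L, ∀ y ∈ R, x ≠ y)
    (hLR : ∃ x ∈ L, ∀ y ∈ R, y < x) :
    ∃ K A B S, L = K ++ A ∧ R = B ++ S ∧ A ≠ [] ∧ (∀ x ∈ A, ∀ y ∈ B, y < x) ∧
      (∀ x ∈ K ++ S, ∀ y ∈ A ++ B, x < y) ∧
      ((K = [] ∧ S = []) ∨ (B ≠ [] ∧ ∃ x ∈ K, ∀ y ∈ S, y < x)) := by
  obtain ⟨x₁, hx₁, hR⟩ := hLR
  rcases eq_or_ne R [] with rfl | hR0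
  · exact ⟨[], L, [], [], by simp, by simp, List.ne_nil_of_mem hx₁, by simp, by simp, by simp⟩
  obtain ⟨y₀, hy₀, hmax⟩ := exists_max_mem hR0
  obtain ⟨K, A, rfl, hK, hA⟩ := h.exists_left (fun y hy => hN y (by simp [hy])) hd hy₀
  have hA0 : A ≠ [] := by
    rintro rfl
    exact (hK x₁ (by simpa using hx₁)).asymm (hR y₀ hy₀)
  rcases eq_or_ne K [] with rfl | hK0
  · exact ⟨[], A, R, [], by simp, by simp, hA0, fun x hx y hy => (hmax y hy).trans_lt (hA x hx),
      by simp, by simp⟩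
  · obtain ⟨x₀, hx₀, hmax'⟩ := exists_max_mem hK0
    obtain ⟨B, S, rfl, hB, hS⟩ := h.exists_right (fun y hy => hN y (by simp [hy])) hd
      (x := x₀) (by simp [hx₀])
    refine ⟨K, A, B, S, rfl, rfl, hA0, ?_, ?_, Or.inr ⟨?_, x₀, hx₀, hS⟩⟩
    · exact fun x hx y hy => (hmax y (by simp [hy])).trans_lt (hA x hx)
    · intro x hx y hy
      have hx' : x ≤ x₀ := by
        rcases List.mem_append.1 hx with hx | hx
        · exact hmax' x hx
        · exact (hS x hx).le
      rcases List.mem_append.1 hy with hy | hy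
      · have := hK x₀ hx₀
        have := hA y hy
        omega
      · exact hx'.trans_lt (hB y hy)
    · rintro rfl
      exact (hS y₀ (by simpa using hy₀)).asymm (hK x₀ hx₀)

/-- The word is the inflation of the maximum of `K m S` by the block `A N B`, which is itself the
direct sum of `A` and the skew sum of `N` and `B`. -/
theorem sepList_glue_right {K A B S : List ℕ} {m N : ℕ} (hm : ∀ x ∈ K ++ S, x < m)
    (hmN : m ≤ N) (hN : ∀ x ∈ A ++ B, m ≤ x ∧ x < N) (hAB : ∀ x ∈ A, ∀ y ∈ B, x < y) :
    SepList ((K ++ A) ++ N :: (B ++ S)) ↔ SepList (K ++ m :: S) ∧ SepList A ∧ SepList B := by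
  have e : (K ++ A) ++ N :: (B ++ S) = K ++ ((A ++ ([N] ++ B)) ++ S) := by simp
  have hb : ∀ y ∈ A ++ ([N] ++ B), m ≤ y := by
    intro y hy
    simp only [List.mem_append, List.mem_singleton] at hy hN
    rcases hy with hy | rfl | hy
    · exact (hN y (Or.inl hy)).1
    · exact hmN
    · exact (hN y (Or.inr hy)).1
  rw [e, sepList_inflate_iff (m := m) (by simp)
    (fun x hx => ⟨hm x (by simp [hx]), fun y hy => (hm x (by simp [hx])).trans_le (hb y hy)⟩)
    (fun x hx => ⟨hm x (by simp [hx]), fun y hy => (hm x (by simp [hx])).trans_le (hb y hy)⟩),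
    sepList_append_of_lt (A := A) (B := [N] ++ B), sepList_append_of_gt (A := [N])]
  · simp only [sepList_singleton, true_and]
  · intro x hx y hy
    rw [List.mem_singleton.1 hx]
    exact (hN y (by simp [hy])).2
  · intro x hx y hy
    rcases List.mem_append.1 hy with hy | hy
    · rw [List.mem_singleton.1 hy]
      exact (hN x (by simp [hx])).2
    · exact hAB x hx y hy

/-- The word is the inflation of the maximum of `K m S` by the block `A N B`, which is itself the
skew sum of `A N` and `B`, the former being a direct sum. -/
theorem sepList_glue_left {K A B S : List ℕ} {m N : ℕ} (hm : ∀ x ∈ K ++ S, x < m)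
    (hmN : m ≤ N) (hN : ∀ x ∈ A ++ B, m ≤ x ∧ x < N) (hAB : ∀ x ∈ A, ∀ y ∈ B, y < x) :
    SepList ((K ++ A) ++ N :: (B ++ S)) ↔ SepList (K ++ m :: S) ∧ SepList A ∧ SepList B := by
  have e : (K ++ A) ++ N :: (B ++ S) = K ++ (((A ++ [N]) ++ B) ++ S) := by simp
  have hb : ∀ y ∈ (A ++ [N]) ++ B, m ≤ y := by
    intro y hy
    simp only [List.mem_append, List.mem_singleton] at hy hN
    rcases hy with (hy | rfl) | hy
    · exact (hN y (Or.inl hy)).1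
    · exact hmN
    · exact (hN y (Or.inr hy)).1
  rw [e, sepList_inflate_iff (m := m) (by simp)
    (fun x hx => ⟨hm x (by simp [hx]), fun y hy => (hm x (by simp [hx])).trans_le (hb y hy)⟩)
    (fun x hx => ⟨hm x (by simp [hx]), fun y hy => (hm x (by simp [hx])).trans_le (hb y hy)⟩),
    sepList_append_of_gt (A := A ++ [N]), sepList_append_of_lt (B := [N])]
  · simp only [sepList_singleton, and_true]
  · intro x hx y hy
    rw [List.mem_singleton.1 hy]
    exact (hN x (by simp [hx])).2
  · intro x hx y hy
    rcases List.mem_append.1 hx with hx | hx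
    · exact hAB x hx y hy
    · rw [List.mem_singleton.1 hx]
      exact (hN y (by simp [hy])).2

theorem countP_lt_eq_zero {L : List ℕ} {x : ℕ} (h : ∀ y ∈ L, x < y) : L.countP (· < x) = 0 :=
  List.countP_eq_zero.2 fun y hy => by simpa using (h y hy).le

theorem countP_lt_eq_length {L : List ℕ} {x : ℕ} (h : ∀ y ∈ L, y < x) :
    L.countP (· < x) = L.length :=
  List.countP_eq_length.2 fun y hy => by simpa using h y hy

/-- A letter of `B` has all letters of `K` and `A` below it; a letter of `S` sees no new smaller
letter. -/
theorem avoidFrom_glue_right {k : ℕ} {K A B S : List ℕ} (hk : K.length + A.length ≤ k)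
    (hlt : ∀ x ∈ K ++ S, ∀ y ∈ A ++ B, x < y) (hAB : ∀ x ∈ A, ∀ y ∈ B, x < y) :
    AvoidFrom k (K ++ A) (B ++ S) ↔
      AvoidFrom (k - (K.length + A.length)) [] B ∧ AvoidFrom k K S := by
  rw [avoidFrom_append]
  refine and_congr (avoidFrom_congr fun x hx => ?_) (avoidFrom_congr fun x hx => ?_)
  · rw [countP_lt_eq_length, List.length_append, List.countP_nil]
    · omega
    · intro y hy
      rcases List.mem_append.1 hy with hy | hy
      · exact hlt y (by simp [hy]) x (by simp [hx])
      · exact hAB y hy x hx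
  · rw [List.append_assoc, List.countP_append,
      countP_lt_eq_zero (L := A ++ B) fun y hy => hlt x (by simp [hx]) y hy, add_zero]

/-- A letter of `B` has all letters of `K`, but none of `A`, below it; a letter of `S` sees no new
smaller letter. -/
theorem avoidFrom_glue_left {k : ℕ} {K A B S : List ℕ} (hk : K.length ≤ k)
    (hlt : ∀ x ∈ K ++ S, ∀ y ∈ A ++ B, x < y) (hAB : ∀ x ∈ A, ∀ y ∈ B, y < x) :
    AvoidFrom k (K ++ A) (B ++ S) ↔ AvoidFrom (k - K.length) [] B ∧ AvoidFrom k K S := by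
  rw [avoidFrom_append]
  refine and_congr (avoidFrom_congr fun x hx => ?_) (avoidFrom_congr fun x hx => ?_)
  · rw [List.countP_append, countP_lt_eq_length, countP_lt_eq_zero, List.countP_nil]
    · omega
    · exact fun y hy => hAB y hy x hx
    · exact fun y hy => hlt y (by simp [hy]) x (by simp [hx])
  · rw [List.append_assoc, List.countP_append,
      countP_lt_eq_zero (L := A ++ B) fun y hy => hlt x (by simp [hx]) y hy, add_zero]

/-! ### Gluing blocks to the maximum -/

/-- The one-line notations of the separable permutations. -/
def sepWords : Set (List ℕ) := {l | IsPerm l ∧ SepList l}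

/-- The one-line notations of the separable permutations avoiding `P_k`. -/
def avoidWords (k : ℕ) : Set (List ℕ) := {l | IsPerm l ∧ SepList l ∧ AvoidFrom k [] l}

/-- The word with left part `p.1`, right part `p.2` and, between them, a letter which is the
maximum if `p.1 ++ p.2` is a permutation word. -/
def insertMax (p : List ℕ × List ℕ) : List ℕ := p.1 ++ (p.1.length + p.2.length) :: p.2

/-- The separable permutations avoiding `P_k` with `i` letters to the left of the maximum, recorded
as the pair of words to the left and to the right of the maximum. The condition on `P_k` is that
on the right part only, which suffices when `i + 2 ≤ k`. -/
def splits (k i : ℕ) : Set (List ℕ × List ℕ) :=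
  {p | p.1.length = i ∧ IsPerm (p.1 ++ p.2) ∧ SepList (insertMax p) ∧ AvoidFrom k p.1 p.2}

/-- The members of `splits k i` whose second largest letter, if any, is to the right of the maximum. -/
def splitsRight (k i : ℕ) : Set (List ℕ × List ℕ) :=
  {p | p ∈ splits k i ∧ ∀ x ∈ p.1, ∃ y ∈ p.2, x < y}

/-- The members of `splits k i` that have a second largest letter, to the left of the maximum. -/
def splitsLeft (k i : ℕ) : Set (List ℕ × List ℕ) :=
  {p | p ∈ splits k i ∧ ∃ x ∈ p.1, ∀ y ∈ p.2, y < x}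

/-- For `q = (B, A, K, S)`, the pair obtained from `(K, S)` by adding, next to the maximum, a block
`A` on the left and a block `B` on the right, with the letters of `K` and `S` below those of `A`
and the letters of `A` below those of `B`. -/
def glueRight (q : List ℕ × List ℕ × List ℕ × List ℕ) : List ℕ × List ℕ :=
  (q.2.2.1 ++ q.2.1.map (q.2.2.1.length + q.2.2.2.length + ·),
    q.1.map (q.2.2.1.length + q.2.2.2.length + q.2.1.length + ·) ++ q.2.2.2)

/-- For `q = (A, B, K, S)`, the pair obtained from `(K, S)` by adding, next to the maximum, a block
`A` on the left and a block `B` on the right, with the letters of `K` and `S` below those of `B`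
and the letters of `B` below those of `A`. -/
def glueLeft (q : List ℕ × List ℕ × List ℕ × List ℕ) : List ℕ × List ℕ :=
  (q.2.2.1 ++ q.1.map (q.2.2.1.length + q.2.2.2.length + q.2.1.length + ·),
    q.2.1.map (q.2.2.1.length + q.2.2.2.length + ·) ++ q.2.2.2)

theorem perm_glue (K A B S : List ℕ) : ((K ++ S) ++ (A ++ B)).Perm ((K ++ A) ++ (B ++ S)) := by
  rw [← Multiset.coe_eq_coe]
  simp only [← Multiset.coe_add]
  abel

theorem perm_glue' (K A B S : List ℕ) : ((K ++ S) ++ (B ++ A)).Perm ((K ++ A) ++ (B ++ S)) := by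
  rw [← Multiset.coe_eq_coe]
  simp only [← Multiset.coe_add]
  abel

theorem strictMono_add (c : ℕ) : StrictMono (c + ·) := fun _ _ h => Nat.add_lt_add_left h c

theorem shift_lt {K S A B : List ℕ} (hKS : IsPerm (K ++ S)) (hA : IsPerm A) :
    (∀ x ∈ K ++ S, ∀ y ∈ A.map (K.length + S.length + ·) ++
      B.map (K.length + S.length + A.length + ·), x < y) ∧
    ∀ x ∈ A.map (K.length + S.length + ·), ∀ y ∈ B.map (K.length + S.length + A.length + ·),
      x < y := by
  constructor
  · intro x hx y hy
    have := hKS.lt hx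
    rw [List.length_append] at this
    simp only [List.mem_append, List.mem_map] at hy
    rcases hy with ⟨z, hz, rfl⟩ | ⟨z, hz, rfl⟩ <;> omega
  · intro x hx y hy
    simp only [List.mem_map] at hx hy
    obtain ⟨a, ha, rfl⟩ := hx
    obtain ⟨b, hb, rfl⟩ := hy
    have := hA.lt ha
    omega

theorem glueRight_mem_splits_iff {k i : ℕ} {K A B S : List ℕ} (hik : i ≤ k)
    (hKS : IsPerm (K ++ S)) (hA : IsPerm A) (hB : IsPerm B) (hi : K.length + A.length = i) :
    glueRight (B, A, K, S) ∈ splits k i ↔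
      B ∈ avoidWords (k - i) ∧ A ∈ sepWords ∧ (K, S) ∈ splits k K.length := by
  obtain ⟨h1, h2⟩ := shift_lt (B := B) hKS hA
  have hp : IsPerm ((K ++ A.map (K.length + S.length + ·)) ++
      (B.map (K.length + S.length + A.length + ·) ++ S)) := by
    have := hKS.append_map (hA.append_map hB)
    simp only [List.length_append, List.map_append, List.map_map, Function.comp_def,
      ← add_assoc] at this
    exact this.perm (perm_glue _ _ _ _)
  have hN := fun x => hp.lt (x := x)
  simp only [List.length_append, List.length_map] at hN
  simp only [splits, glueRight, insertMax, Set.mem_ofPred_eq, avoidWords, sepWords,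
    List.length_append, List.length_map, hA, hB, hKS, hp, hi, true_and]
  rw [sepList_glue_right (m := K.length + S.length) (fun x hx => by simpa using hKS.lt hx)
    (by omega) _ h2, avoidFrom_glue_right (by simpa using hi ▸ hik) h1 h2]
  · rw [sepList_map (strictMono_add _), sepList_map (strictMono_add _), List.length_map, hi,
      show ([] : List ℕ) = [].map (K.length + S.length + A.length + ·) from rfl,
      avoidFrom_map (strictMono_add _)]
    tauto
  · intro x hx
    constructor
    · simp only [List.mem_append, List.mem_map] at hx
      rcases hx with ⟨z, hz, rfl⟩ | ⟨z, hz, rfl⟩ <;> omega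
    · have := @hN x
      simp only [List.mem_append] at this hx
      have := this (by tauto)
      omega

theorem glueLeft_mem_splits_iff {k i : ℕ} {K A B S : List ℕ} (hik : i ≤ k)
    (hKS : IsPerm (K ++ S)) (hA : IsPerm A) (hB : IsPerm B) (hi : K.length + A.length = i) :
    glueLeft (A, B, K, S) ∈ splits k i ↔
      A ∈ sepWords ∧ B ∈ avoidWords (k - K.length) ∧ (K, S) ∈ splits k K.length := by
  obtain ⟨h1, h2⟩ := shift_lt (B := A) hKS hB
  replace h1 : ∀ x ∈ K ++ S, ∀ y ∈ A.map (K.length + S.length + B.length + ·) ++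
      B.map (K.length + S.length + ·), x < y := fun x hx y hy =>
    h1 x hx y (by simp only [List.mem_append] at hy ⊢; tauto)
  have hp : IsPerm ((K ++ A.map (K.length + S.length + B.length + ·)) ++
      (B.map (K.length + S.length + ·) ++ S)) := by
    have := hKS.append_map (hB.append_map hA)
    simp only [List.length_append, List.map_append, List.map_map, Function.comp_def,
      ← add_assoc] at this
    exact this.perm (perm_glue' _ _ _ _)
  have hN := fun x => hp.lt (x := x)
  simp only [List.length_append, List.length_map] at hN
  simp only [splits, glueLeft, insertMax, Set.mem_ofPred_eq, avoidWords, sepWords,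
    List.length_append, List.length_map, hA, hB, hKS, hp, hi, true_and]
  rw [sepList_glue_left (m := K.length + S.length) (fun x hx => by simpa using hKS.lt hx)
    (by omega) _ (fun x hx y hy => h2 y hy x hx), avoidFrom_glue_left (by omega) h1
    (fun x hx y hy => h2 y hy x hx)]
  · rw [sepList_map (strictMono_add _), sepList_map (strictMono_add _),
      show ([] : List ℕ) = [].map (K.length + S.length + ·) from rfl,
      avoidFrom_map (strictMono_add _)]
    tauto
  · intro x hx
    constructor
    · simp only [List.mem_append, List.mem_map] at hx
      rcases hx with ⟨z, hz, rfl⟩ | ⟨z, hz, rfl⟩ <;> omega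
    · have := @hN x
      simp only [List.mem_append] at this hx
      have := this (by tauto)
      omega

/-! ### Cutting and gluing blocks as bijections -/

theorem exists_unshift {K A B S : List ℕ} (h : IsPerm ((K ++ A) ++ (B ++ S)))
    (hlt : ∀ x ∈ K ++ S, ∀ y ∈ A ++ B, x < y) (hAB : ∀ x ∈ A, ∀ y ∈ B, x < y) :
    IsPerm (K ++ S) ∧ ∃ A' B', IsPerm A' ∧ IsPerm B' ∧
      A = A'.map (K.length + S.length + ·) ∧
      B = B'.map (K.length + S.length + A'.length + ·) := by
  obtain ⟨hKS, Q, hQ, e⟩ := (h.perm (perm_glue K A B S).symm).of_append_lt hlt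
  obtain ⟨A', B₁, rfl, rfl, rfl⟩ := List.append_eq_map_iff.1 e
  have hAB' : ∀ x ∈ A', ∀ y ∈ B₁, x < y := fun x hx y hy =>
    (strictMono_add _).lt_iff_lt.1 (hAB _ (List.mem_map_of_mem hx) _ (List.mem_map_of_mem hy))
  obtain ⟨hA', B', hB', rfl⟩ := hQ.of_append_lt hAB'
  refine ⟨hKS, A', B', hA', hB', by simp, ?_⟩
  simp [Function.comp_def, add_assoc]

/-- A concatenation determines its two parts if a property of letters separates them. -/
theorem append_inj_of_forall (p : ℕ → Prop) {A B A' B' : List ℕ} (h : A ++ B = A' ++ B')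
    (hA : ∀ x ∈ A, p x) (hB : ∀ x ∈ B, ¬ p x) (hA' : ∀ x ∈ A', p x) (hB' : ∀ x ∈ B', ¬ p x) :
    A = A' ∧ B = B' := by
  classical
  have key : A = A' := by
    have := congrArg (List.filter p) h
    rwa [List.filter_append, List.filter_append,
      List.filter_eq_self.2 (show ∀ x ∈ A, decide (p x) = true by simpa using hA),
      List.filter_eq_self.2 (show ∀ x ∈ A', decide (p x) = true by simpa using hA'),
      List.filter_eq_nil_iff.2 (show ∀ x ∈ B, ¬ decide (p x) = true by simpa using hB),
      List.filter_eq_nil_iff.2 (show ∀ x ∈ B', ¬ decide (p x) = true by simpa using hB'), List.append_nil, List.append_nil] at this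
  subst key
  exact ⟨rfl, List.append_cancel_left h⟩

theorem map_add_injective (c : ℕ) : Function.Injective (List.map (c + ·)) :=
  List.map_injective_iff.2 (add_right_injective c)

/-- The data `(B, A, K, S)` glued by `glueRight` to the members of `splitsRight k i`, where `A` has
`j` letters. -/
def rightBlocks (k i j : ℕ) : Set (List ℕ × List ℕ × List ℕ × List ℕ) :=
  {l | l ∈ avoidWords (k - i) ∧ l ≠ []} ×ˢ {l | l ∈ sepWords ∧ l.length = j} ×ˢ
    splitsRight k (i - j)

/-- The data `(A, B, K, S)` glued by `glueLeft` to the members of `splitsLeft k i`, where `A` has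
`j` letters, fewer than all those to the left of the maximum. -/
def leftBlocks (k i j : ℕ) : Set (List ℕ × List ℕ × List ℕ × List ℕ) :=
  {l | l ∈ sepWords ∧ l.length = j} ×ˢ {l | l ∈ avoidWords (k - i + j) ∧ l ≠ []} ×ˢ
    splitsLeft k (i - j)

/-- The data `(A, B, [], [])` glued by `glueLeft` to the members of `splitsLeft k i` in which all the
letters to the left of the maximum exceed those to its right. -/
def leftCore (k i : ℕ) : Set (List ℕ × List ℕ × List ℕ × List ℕ) :=
  {l | l ∈ sepWords ∧ l.length = i} ×ˢ avoidWords k ×ˢ {([], [])}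

theorem glueRight_injective {k i j j' : ℕ} (hj : 1 ≤ j) (hj' : 1 ≤ j')
    {q q' : List ℕ × List ℕ × List ℕ × List ℕ} (hq : q ∈ rightBlocks k i j)
    (hq' : q' ∈ rightBlocks k i j') (h : glueRight q = glueRight q') : q = q' := by
  obtain ⟨B, A, K, S⟩ := q
  obtain ⟨B', A', K', S'⟩ := q'
  obtain ⟨⟨hB, hB0⟩, ⟨hA, hA0⟩, ⟨hKS, hdom⟩⟩ := hq
  obtain ⟨⟨hB', hB0'⟩, ⟨hA', hA0'⟩, ⟨hKS', hdom'⟩⟩ := hq'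
  simp only at hA0 hA0' hdom hdom'
  obtain ⟨h1, h2⟩ := shift_lt (B := B) hKS.2.1 hA.1
  obtain ⟨h1', h2'⟩ := shift_lt (B := B') hKS'.2.1 hA'.1
  simp only [glueRight, Prod.mk.injEq] at h
  obtain ⟨e1, e2⟩ := h
  set As := A.map (K.length + S.length + ·) with hAs
  set As' := A'.map (K'.length + S'.length + ·) with hAs'
  set Bs := B.map (K.length + S.length + A.length + ·) with hBs
  set Bs' := B'.map (K'.length + S'.length + A'.length + ·) with hBs'
  have hne : As ≠ [] := by
    rw [hAs, ne_eq, List.map_eq_nil_iff]; rintro rfl; simp at hA0; omega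
  have hne' : As' ≠ [] := by
    rw [hAs', ne_eq, List.map_eq_nil_iff]; rintro rfl; simp at hA0'; omega
  obtain ⟨a, ha⟩ := List.exists_mem_of_ne_nil _ hne
  obtain ⟨a', ha'⟩ := List.exists_mem_of_ne_nil _ hne'
  -- `B` consists of the letters above the whole left part, as `A` is nonempty and above `S`.
  obtain ⟨eB, rfl⟩ := append_inj_of_forall (fun y => ∀ x ∈ K ++ As, x < y) e2
    (fun y hy x hx => (List.mem_append.1 hx).elim
      (fun hx => h1 x (by simp [hx]) y (by simp [hy])) fun hx => h2 x hx y hy)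
    (fun y hy H => (H a (by simp [ha])).asymm (h1 y (by simp [hy]) a (by simp [ha])))
    (fun y hy x hx => (List.mem_append.1 (e1 ▸ hx)).elim
      (fun hx => h1' x (by simp [hx]) y (by simp [hy])) fun hx => h2' x hx y hy)
    (fun y hy H => (H a' (e1 ▸ by simp [ha'])).asymm (h1' y (by simp [hy]) a' (by simp [ha'])))
  -- `K` consists of the letters below some letter of `S`.
  obtain ⟨rfl, eA⟩ := append_inj_of_forall (fun x => ∃ y ∈ S, x < y) e1 hdom
    (fun x hx ⟨y, hy, hxy⟩ => hxy.asymm (h1 y (by simp [hy]) x (by simp [hx]))) hdom'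
    (fun x hx ⟨y, hy, hxy⟩ => hxy.asymm (h1' y (by simp [hy]) x (by simp [hx])))
  obtain rfl : A = A' := map_add_injective _ eA
  obtain rfl : B = B' := map_add_injective _ eB
  rfl

theorem glueLeft_injective {k i j j' : ℕ}
    {q q' : List ℕ × List ℕ × List ℕ × List ℕ} (hq : q ∈ leftBlocks k i j)
    (hq' : q' ∈ leftBlocks k i j') (h : glueLeft q = glueLeft q') : q = q' := by
  obtain ⟨A, B, K, S⟩ := q
  obtain ⟨A', B', K', S'⟩ := q'
  obtain ⟨⟨hA, hA0⟩, ⟨hB, hB0⟩, ⟨hKS, c, hc, hdom⟩⟩ := hq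
  obtain ⟨⟨hA', hA0'⟩, ⟨hB', hB0'⟩, ⟨hKS', c', hc', hdom'⟩⟩ := hq'
  simp only at hA0 hA0' hB0 hB0' hdom hdom' hc hc'
  obtain ⟨h1, h2⟩ := shift_lt (B := A) hKS.2.1 hB.1
  obtain ⟨h1', h2'⟩ := shift_lt (B := A') hKS'.2.1 hB'.1
  simp only [glueLeft, Prod.mk.injEq] at h
  obtain ⟨e1, e2⟩ := h
  set Bs := B.map (K.length + S.length + ·) with hBs
  set Bs' := B'.map (K'.length + S'.length + ·) with hBs'
  set As := A.map (K.length + S.length + B.length + ·) with hAs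
  set As' := A'.map (K'.length + S'.length + B'.length + ·) with hAs'
  have hne : Bs ≠ [] := by simpa [hBs] using hB0
  have hne' : Bs' ≠ [] := by simpa [hBs'] using hB0'
  obtain ⟨b, hb⟩ := List.exists_mem_of_ne_nil _ hne
  obtain ⟨b', hb'⟩ := List.exists_mem_of_ne_nil _ hne'
  have hS : ∀ x ∈ As, ∀ y ∈ Bs ++ S, y < x := fun x hx y hy => (List.mem_append.1 hy).elim
    (fun hy => h2 y hy x hx) fun hy => h1 y (by simp [hy]) x (by simp [hx])
  have hS' : ∀ x ∈ As', ∀ y ∈ Bs' ++ S', y < x := fun x hx y hy => (List.mem_append.1 hy).elim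
    (fun hy => h2' y hy x hx) fun hy => h1' y (by simp [hy]) x (by simp [hx])
  -- `K` consists of the letters below some letter of the right part, as `B` is nonempty.
  obtain ⟨rfl, eA⟩ := append_inj_of_forall (fun x => ∃ y ∈ Bs ++ S, x < y) e1
    (fun x hx => ⟨b, by simp [hb], h1 x (by simp [hx]) b (by simp [hb])⟩)
    (fun x hx ⟨y, hy, hxy⟩ => hxy.asymm (hS x hx y hy))
    (fun x hx => ⟨b', e2 ▸ by simp [hb'], h1' x (by simp [hx]) b' (by simp [hb'])⟩)
    (fun x hx ⟨y, hy, hxy⟩ => hxy.asymm (hS' x hx y (e2 ▸ hy)))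
  -- `B` consists of the letters above all of `K`, as the maximum of `K` and `S` is in `K`.
  obtain ⟨eB, rfl⟩ := append_inj_of_forall (fun y => ∀ x ∈ K, x < y) e2
    (fun y hy x hx => h1 x (by simp [hx]) y (by simp [hy]))
    (fun y hy H => (H c hc).asymm (hdom y hy))
    (fun y hy x hx => h1' x (by simp [hx]) y (by simp [hy]))
    (fun y hy H => (H c' hc').asymm (hdom' y hy))
  obtain rfl : B = B' := map_add_injective _ eB
  obtain rfl : A = A' := map_add_injective _ eA
  rfl

theorem IsPerm.ne_of_append {L R : List ℕ} (h : IsPerm (L ++ R)) :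
    ∀ x ∈ L, ∀ y ∈ R, x ≠ y := fun _ hx _ hy => (List.nodup_append.1 h.nodup).2.2 _ hx _ hy

theorem splitsRight_eq {k i : ℕ} (hi : 1 ≤ i) (hik : i ≤ k) :
    splitsRight k i = ⋃ j ∈ Finset.Icc 1 i, glueRight '' rightBlocks k i j := by
  ext ⟨L, R⟩
  simp only [Set.mem_iUnion, Finset.mem_Icc, exists_prop]
  constructor
  · rintro ⟨⟨hLi, hP, hsep, hav⟩, hdom⟩
    simp only at hLi hP hdom
    have hL : L ≠ [] := by rintro rfl; simp at hLi; omega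
    obtain ⟨K, A, B, S, rfl, rfl, hA0, hB0, hAB, hlt, hKS⟩ := hsep.exists_blocks_of_right
      (fun x hx => by simpa using hP.lt hx) hP.ne_of_append hL hdom
    obtain ⟨hKSP, A, B, hA, hB, rfl, rfl⟩ := exists_unshift hP hlt hAB
    simp only [List.length_append, List.length_map] at hLi
    have := (glueRight_mem_splits_iff hik hKSP hA hB hLi).1
      ⟨by simpa [glueRight] using hLi, hP, hsep, hav⟩
    have hA1 : A.length ≠ 0 := by simpa using hA0
    refine ⟨A.length, ⟨by omega, by omega⟩, (B, A, K, S), ⟨⟨this.1, by simpa using hB0⟩,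
      ⟨this.2.1, rfl⟩, ?_, hKS⟩, rfl⟩
    rw [← hLi, Nat.add_sub_cancel]
    exact this.2.2
  · rintro ⟨j, ⟨h1, h2⟩, ⟨B, A, K, S⟩, ⟨⟨hB, hB0⟩, ⟨hA, hAj⟩, hKS, hdom⟩, e⟩
    rw [← e]
    simp only at hAj hB0
    have hK : K.length = i - j := hKS.1
    have hKA : K.length + A.length = i := by omega
    refine ⟨(glueRight_mem_splits_iff hik hKS.2.1 hA.1 hB.1 hKA).2 ⟨hB, hA, ?_⟩, ?_⟩
    · rw [hK]; exact hKS
    · obtain ⟨h1, h2⟩ := shift_lt (B := B) hKS.2.1 hA.1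
      obtain ⟨b, hb⟩ := List.exists_mem_of_ne_nil _ hB0
      have hb' := List.mem_map_of_mem (f := (K.length + S.length + A.length + ·)) hb
      intro x hx
      refine ⟨_, List.mem_append_left _ hb', ?_⟩
      rcases List.mem_append.1 hx with hx | hx
      · exact h1 x (by simp [hx]) _ (List.mem_append_right _ hb')
      · exact h2 x hx _ hb'

theorem splitsLeft_eq {k i : ℕ} (hi : 1 ≤ i) (hik : i ≤ k) :
    splitsLeft k i = glueLeft '' leftCore k i ∪
      ⋃ j ∈ Finset.Icc 1 (i - 1), glueLeft '' leftBlocks k i j := by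
  ext ⟨L, R⟩
  simp only [Set.mem_union, Set.mem_iUnion, Finset.mem_Icc, exists_prop]
  constructor
  · rintro ⟨⟨hLi, hP, hsep, hav⟩, hdom⟩
    simp only at hLi hP hdom
    obtain ⟨K, A, B, S, rfl, rfl, hA0, hAB, hlt, hKS⟩ := hsep.exists_blocks_of_left
      (fun x hx => by simpa using hP.lt hx) hP.ne_of_append hdom
    obtain ⟨hKSP, B, A, hB, hA, rfl, rfl⟩ := exists_unshift
      (hP.perm ((perm_glue' K _ _ S).symm.trans (perm_glue _ _ _ _)))
      (fun x hx y hy => hlt x hx y (by simp only [List.mem_append] at hy ⊢; tauto))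
      (fun x hx y hy => hAB y hy x hx)
    simp only [List.length_append, List.length_map] at hLi
    have := (glueLeft_mem_splits_iff hik hKSP hA hB hLi).1
      ⟨by simpa [glueLeft] using hLi, hP, hsep, hav⟩
    have hA1 : A.length ≠ 0 := by simpa using hA0
    rcases hKS with ⟨rfl, rfl⟩ | ⟨hB0, hKS⟩
    · left
      exact ⟨(A, B, [], []), ⟨⟨this.1, by simpa using hLi⟩, by simpa using this.2.1, rfl⟩, rfl⟩
    · right
      have hK : K.length ≠ 0 := by
        obtain ⟨x, hx, -⟩ := hKS
        exact (List.length_pos_of_mem hx).ne'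
      refine ⟨A.length, ⟨by omega, by omega⟩, (A, B, K, S), ⟨⟨this.1, rfl⟩,
        ⟨?_, by simpa using hB0⟩, ?_, hKS⟩, rfl⟩
      · rw [show k - i + A.length = k - K.length by omega]
        exact this.2.1
      · rw [← hLi, Nat.add_sub_cancel]
        exact this.2.2
  · rintro (⟨⟨A, B, K, S⟩, ⟨⟨hA, hAi⟩, hB, hKS⟩, e⟩ |
      ⟨j, ⟨h1, h2⟩, ⟨A, B, K, S⟩, ⟨⟨hA, hAj⟩, ⟨hB, hB0⟩, hKS, hdom⟩, e⟩)
    · rw [← e]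
      simp only [Set.mem_singleton_iff, Prod.mk.injEq] at hAi hKS hB
      obtain ⟨rfl, rfl⟩ := hKS
      have hnil : IsPerm ([] ++ []) := List.Perm.refl _
      refine ⟨(glueLeft_mem_splits_iff hik hnil hA.1 hB.1 (by simpa using hAi)).2
        ⟨hA, by simpa using hB, rfl, hnil, sepList_singleton _, trivial⟩, ?_⟩
      obtain ⟨h1, h2⟩ := shift_lt (B := A) hnil hB.1
      obtain ⟨a, ha⟩ := List.exists_mem_of_length_pos (hAi ▸ hi : 0 < A.length)
      have ha' := List.mem_map_of_mem (f := (([] : List ℕ).length + ([] : List ℕ).length +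
        B.length + ·)) ha
      exact ⟨_, ha', fun y hy => h2 y (by simpa [glueLeft] using hy) _ ha'⟩
    · rw [← e]
      simp only at hAj hB0
      have hK : K.length = i - j := hKS.1
      have hKA : K.length + A.length = i := by omega
      refine ⟨(glueLeft_mem_splits_iff hik hKS.2.1 hA.1 hB.1 hKA).2 ⟨hA, ?_, ?_⟩, ?_⟩
      · rw [show k - K.length = k - i + j by omega]; exact hB
      · rw [hK]; exact hKS
      · obtain ⟨h1, h2⟩ := shift_lt (B := A) hKS.2.1 hB.1
        obtain ⟨a, ha⟩ := List.exists_mem_of_length_pos (by omega : 0 < A.length)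
        have ha' := List.mem_map_of_mem (f := (K.length + S.length + B.length + ·)) ha
        refine ⟨_, List.mem_append_right _ ha', fun y hy => ?_⟩
        rcases List.mem_append.1 hy with hy | hy
        · exact h2 y hy _ ha'
        · exact h1 y (by simp [hy]) _ (List.mem_append_right _ ha')

theorem disjoint_glueLeft {k i j : ℕ} :
    Disjoint (glueLeft '' leftCore k i) (glueLeft '' leftBlocks k i j) := by
  rw [Set.disjoint_left]
  rintro p ⟨⟨A, B, K, S⟩, ⟨-, hB, hKS⟩, rfl⟩
    ⟨⟨A', B', K', S'⟩, ⟨-, ⟨hB', hB0'⟩, hKS', c', hc', -⟩, e⟩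
  simp only [Set.mem_singleton_iff, Prod.mk.injEq] at hKS hB hB0'
  obtain ⟨rfl, rfl⟩ := hKS
  obtain ⟨h1, h2⟩ := shift_lt (B := A) (List.Perm.refl _ : IsPerm ([] ++ [])) hB.1
  obtain ⟨h1', h2'⟩ := shift_lt (B := A') hKS'.2.1 hB'.1
  simp only [glueLeft, Prod.mk.injEq, List.append_nil, List.nil_append] at e
  obtain ⟨b, hb⟩ := List.exists_mem_of_ne_nil _ hB0'
  have hb' := List.mem_map_of_mem (f := (K'.length + S'.length + ·)) hb
  have h3 := h1' c' (List.mem_append_left _ hc') _ (List.mem_append_left _ hb')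
  have h4 := h2 _ (e.2 ▸ List.mem_append_left _ hb') c' (e.1 ▸ List.mem_append_left _ hc')
  exact h3.asymm h4

/-! ### The defining series as generating functions of lists -/

/-- The weight `u ^ lmax * v ^ rmax` of a word. -/
noncomputable def wordWeight (l : List ℕ) : Poly := u ^ lmaxList l * v ^ rmaxList l

/-- The weight of the word `insertMax p`, the maximum counting for both statistics. -/
noncomputable def splitWeight (p : List ℕ × List ℕ) : Poly := u ^ (lmaxList p.1 + 1) * v ^ (rmaxList p.2 + 1)

/-- The length of the word `insertMax p`. -/
def splitSize (p : List ℕ × List ℕ) : ℕ := p.1.length + p.2.length + 1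

theorem weightSum_eq {n : ℕ} (S : Set (Perm (Fin n))) :
    weightSum S = ∑ᶠ l ∈ oneLine '' S, wordWeight l := by
  rw [finsum_mem_image oneLine_injective.injOn, weightSum, ← finsum_mem_coe_finset,
    Set.Finite.coe_toFinset]
  exact finsum_mem_congr rfl fun π _ => by rw [wordWeight, lmax_eq, rmax_eq]

theorem image_oneLine {n : ℕ} {S : Set (Perm (Fin n))} {T : Set (List ℕ)}
    (hT : ∀ l ∈ T, IsPerm l) (h : ∀ π, oneLine π ∈ T ↔ π ∈ S) :
    oneLine '' S = {l | l ∈ T ∧ l.length = n} := by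
  ext l
  constructor
  · rintro ⟨π, hπ, rfl⟩
    exact ⟨(h π).2 hπ, length_oneLine π⟩
  · rintro ⟨hl, hn⟩
    obtain ⟨π, rfl⟩ := exists_oneLine_eq (hT l hl) hn
    exact ⟨π, (h π).1 hl, rfl⟩

theorem mk_weightSum (S : ∀ n, Set (Perm (Fin n))) {T : Set (List ℕ)} (hT : ∀ l ∈ T, IsPerm l)
    (h : ∀ n (π : Perm (Fin n)), oneLine π ∈ T ↔ π ∈ S n) :
    (PowerSeries.mk fun n => weightSum (S n)) = gf T List.length wordWeight := by
  ext1 n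
  rw [coeff_mk, coeff_gf, weightSum_eq, image_oneLine hT (h n)]

theorem oneLine_mem_sepWords {n : ℕ} (π : Perm (Fin n)) :
    oneLine π ∈ sepWords ↔ π ∈ separable n := by
  rw [← sepList_oneLine]
  exact and_iff_right (isPerm_oneLine π)

theorem oneLine_mem_avoidWords {k n : ℕ} (hk : 1 ≤ k) (π : Perm (Fin n)) :
    oneLine π ∈ avoidWords k ↔ π ∈ sepAvoid k n := by
  rw [sepAvoid, Set.mem_ofPred_eq, ← sepList_oneLine, ← avoidFrom_oneLine hk]
  exact and_iff_right (isPerm_oneLine π)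

theorem finiteFibers_isPerm : FiniteFibers {l | IsPerm l} List.length := finite_isPerm

theorem finiteFibers_sepWords : FiniteFibers sepWords List.length :=
  finiteFibers_isPerm.mono fun _ h => h.1

theorem finiteFibers_avoidWords (k : ℕ) : FiniteFibers (avoidWords k) List.length :=
  finiteFibers_isPerm.mono fun _ h => h.1

theorem finiteFibers_splits (k i : ℕ) : FiniteFibers (splits k i) splitSize := by
  intro n
  refine ((finite_isPerm (n - 1)).image fun l => (l.take i, l.drop i)).subset ?_
  rintro ⟨L, R⟩ ⟨⟨rfl, h, -⟩, rfl⟩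
  exact ⟨L ++ R, ⟨h, by simp [splitSize]⟩, by simp⟩

theorem IsPerm.insertMax {p : List ℕ × List ℕ} (h : IsPerm (p.1 ++ p.2)) :
    IsPerm (insertMax p) := by
  have h0 : IsPerm [0] := List.Perm.refl _
  refine (h.append_map h0).perm ?_
  simp only [List.map_cons, List.map_nil, List.length_append, add_zero]
  exact (List.perm_append_singleton _ _).trans List.perm_middle.symm

theorem isPerm_of_insertMax {p : List ℕ × List ℕ} (h : IsPerm (insertMax p)) :
    IsPerm (p.1 ++ p.2) := by
  have h1 : IsPerm ((p.1 ++ p.2) ++ [p.1.length + p.2.length]) :=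
    h.perm (List.perm_middle.trans (List.perm_append_singleton _ _).symm)
  refine (h1.of_append_lt fun x hx y hy => ?_).1
  rw [List.mem_singleton] at hy
  have h2 := h1.lt (List.mem_append_left _ hx)
  have h3 := h1.ne_of_append x hx (p.1.length + p.2.length) (by simp)
  simp only [List.length_append, List.length_singleton] at h2
  omega

theorem length_insertMax (p : List ℕ × List ℕ) : (insertMax p).length = splitSize p := by
  simp [insertMax, splitSize, add_assoc]

theorem wordWeight_insertMax {p : List ℕ × List ℕ} (h : IsPerm (p.1 ++ p.2)) :
    wordWeight (insertMax p) = splitWeight p := by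
  have h1 : ∀ x ∈ p.1, x < p.1.length + p.2.length := fun x hx => by
    simpa using h.lt (List.mem_append_left _ hx)
  have h2 : ∀ x ∈ p.2, x < p.1.length + p.2.length := fun x hx => by
    simpa using h.lt (List.mem_append_right _ hx)
  rw [wordWeight, insertMax, lmaxList_append_cons h1 h2, rmaxList_append_cons h1 h2, splitWeight]

theorem insertMax_injOn : Set.InjOn insertMax {p | IsPerm (p.1 ++ p.2)} := by
  rintro ⟨L, R⟩ h ⟨L', R'⟩ h' e
  have hN : L.length + R.length = L'.length + R'.length := by
    have := congrArg List.length e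
    simpa [length_insertMax, splitSize] using this
  simp only [insertMax, hN] at e
  have hmem : ∀ x ∈ L' ++ R', x ≠ L'.length + R'.length := fun x hx => by
    have := IsPerm.lt h' hx
    simp only [List.length_append] at this
    omega
  obtain ⟨rfl, -, rfl⟩ := (List.append_cons_inj_of_notMem
    (fun H => hmem _ (List.mem_append_left _ H) rfl)
    (fun H => hmem _ (List.mem_append_right _ H) rfl)).1 e.symm
  rfl

theorem insertMax_mem_avoidWords {k : ℕ} {p : List ℕ × List ℕ} (hp : p.1.length + 2 ≤ k) :
    insertMax p ∈ avoidWords k ↔ p ∈ splits k p.1.length := by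
  have key : IsPerm (p.1 ++ p.2) → (AvoidFrom k [] (insertMax p) ↔ AvoidFrom k p.1 p.2) := by
    intro h
    rw [insertMax, avoidFrom_append, List.nil_append, AvoidFrom,
      and_iff_right (avoidFrom_of_length (by simpa using by omega))]
    have h1 : p.1.countP (· < p.1.length + p.2.length) ≤ p.1.length := List.countP_le_length
    rw [and_iff_right (by omega)]
    refine avoidFrom_congr fun x hx => ?_
    have := h.lt (List.mem_append_right _ hx)
    simp only [List.length_append] at this
    rw [List.countP_append, countP_lt_eq_zero (L := [_]) (by simpa using this), add_zero]
  constructor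
  · rintro ⟨h1, h2, h3⟩
    have h := isPerm_of_insertMax h1
    exact ⟨rfl, h, h2, (key h).1 h3⟩
  · rintro ⟨-, h, h2, h3⟩
    exact ⟨h.insertMax, h2, (key h).2 h3⟩

theorem oneLine_split {n : ℕ} (π : Perm (Fin n)) (p : Fin n) :
    ∃ L R, oneLine π = L ++ (π p : ℕ) :: R ∧ L.length = p := by
  have hp : (p : ℕ) < (oneLine π).length := by rw [length_oneLine]; exact p.2
  refine ⟨(oneLine π).take p, (oneLine π).drop (p + 1), ?_, by simp; omega⟩
  have : (oneLine π)[(p : ℕ)] = (π p : ℕ) := by simp [oneLine]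
  rw [← this, ← List.drop_eq_getElem_cons hp, List.take_append_drop]

/-- Positions in the one-line notation, relative to a letter `N` that splits it. -/
theorem mem_split_iff {n : ℕ} {π : Perm (Fin n)} {L R : List ℕ} {N : ℕ}
    (h : oneLine π = L ++ N :: R) (x : ℕ) :
    (x ∈ L ↔ ∃ i : Fin n, (i : ℕ) < L.length ∧ (π i : ℕ) = x) ∧
    (x ∈ R ↔ ∃ i : Fin n, L.length < (i : ℕ) ∧ (π i : ℕ) = x) ∧
    (∀ i : Fin n, (i : ℕ) = L.length → (π i : ℕ) = N) := by
  have hn : n = L.length + (R.length + 1) := by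
    rw [← length_oneLine π, h]; simp
  have hget : ∀ i : Fin n, some (π i : ℕ) = (L ++ N :: R)[(i : ℕ)]? := by
    intro i; rw [← h]; simp [oneLine]
  refine ⟨?_, ?_, ?_⟩
  · rw [List.mem_iff_getElem?]
    constructor
    · rintro ⟨i, hi⟩
      have hiL := (List.getElem?_eq_some_iff.1 hi).1
      refine ⟨⟨i, by omega⟩, hiL, ?_⟩
      have := hget ⟨i, by omega⟩
      rw [List.getElem?_append_left hiL, hi] at this
      exact Option.some.inj this
    · rintro ⟨i, hi, rfl⟩
      exact ⟨i, by rw [hget i, List.getElem?_append_left hi]⟩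
  · rw [List.mem_iff_getElem?]
    constructor
    · rintro ⟨i, hi⟩
      have hiR := (List.getElem?_eq_some_iff.1 hi).1
      refine ⟨⟨L.length + (i + 1), by omega⟩, by simp, ?_⟩
      have := hget ⟨L.length + (i + 1), by omega⟩
      rw [List.getElem?_append_right (by simp), Nat.add_sub_cancel_left,
        List.getElem?_cons_succ, hi] at this
      exact Option.some.inj this
    · rintro ⟨i, hi, rfl⟩
      refine ⟨i - L.length - 1, ?_⟩
      rw [hget i, List.getElem?_append_right hi.le]
      obtain ⟨j, hj⟩ : ∃ j, (i : ℕ) - L.length = j + 1 := ⟨i - L.length - 1, by omega⟩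
      rw [hj, List.getElem?_cons_succ, Nat.add_sub_cancel]
  · intro i hi
    have := hget i
    rw [hi, List.getElem?_append_right le_rfl] at this
    simpa using this

theorem exists_split_of_max {n : ℕ} {π : Perm (Fin n)} {p : Fin n} (hp : (π p : ℕ) + 1 = n) :
    ∃ q : List ℕ × List ℕ, insertMax q = oneLine π ∧ q.1.length = p ∧
      q.1.length + q.2.length + 1 = n := by
  obtain ⟨L, R, e, hL⟩ := oneLine_split π p
  have hn : n = L.length + (R.length + 1) := by
    rw [← length_oneLine π, e]; simp
  refine ⟨(L, R), ?_, hL, by simp only; omega⟩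
  rw [e, insertMax, show (π p : ℕ) = L.length + R.length by omega]

theorem maxAtNextRight_iff {n i : ℕ} (π : Perm (Fin n)) :
    MaxAtNextRight i π ↔ ∃ q : List ℕ × List ℕ, insertMax q = oneLine π ∧ q.1.length = i ∧
      ∀ x ∈ q.1, ∃ y ∈ q.2, x < y := by
  have inj : ∀ {a b : Fin n}, (π a : ℕ) = π b → a = b := fun h => π.injective (Fin.ext h)
  constructor
  · rintro ⟨p, hp, rfl, hq⟩
    obtain ⟨⟨L, R⟩, e, hL, hn⟩ := exists_split_of_max hp
    have e' : oneLine π = L ++ (L.length + R.length) :: R := e.symm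
    simp only at hL hn
    refine ⟨(L, R), e, hL, fun x hx => ?_⟩
    obtain ⟨i, hi, rfl⟩ := ((mem_split_iff e' x).1).1 hx
    have hip : i ≠ p := by rintro rfl; omega
    have h1 : (π i : ℕ) ≠ π p := fun h => hip (inj h)
    have h2 := (π i).2
    set q := π.symm ⟨n - 2, by omega⟩ with hqdef
    have hπq : (π q : ℕ) = n - 2 := by simp [q]
    have hpq : p < q := hq q (by omega)
    have h3 : (π i : ℕ) ≠ π q := fun h => by
      have := inj h
      have := Fin.lt_def.1 hpq
      have : (i : ℕ) = q := by rw [inj h]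
      omega
    exact ⟨π q, (mem_split_iff e' _).2.1.2 ⟨q, by have := Fin.lt_def.1 hpq; omega, rfl⟩,
      by omega⟩
  · rintro ⟨⟨L, R⟩, e, rfl, hd⟩
    have hn : splitSize (L, R) = n := by rw [← length_insertMax, e, length_oneLine]
    have e' : oneLine π = L ++ (L.length + R.length) :: R := e.symm
    simp only [splitSize] at hn
    have hp := (mem_split_iff e' 0).2.2 ⟨L.length, by omega⟩ rfl
    simp only at hd
    refine ⟨⟨L.length, by omega⟩, by omega, rfl, fun q hq => ?_⟩
    by_contra hlt
    rw [Fin.lt_def] at hlt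
    simp only [not_lt] at hlt
    rcases hlt.lt_or_eq with hlt | heq
    · obtain ⟨y, hy, hxy⟩ := hd (π q) ((mem_split_iff e' _).1.2 ⟨q, hlt, rfl⟩)
      obtain ⟨j, hj, rfl⟩ := (mem_split_iff e' y).2.1.1 hy
      have h2 := (π j).2
      have h3 := inj (show (π j : ℕ) = π ⟨L.length, by omega⟩ by rw [hp]; omega)
      rw [h3] at hj
      simp at hj
    · have := (mem_split_iff e' 0).2.2 q heq
      omega

theorem maxAtNextLeft_iff {n i : ℕ} (π : Perm (Fin n)) :
    MaxAtNextLeft i π ↔ ∃ q : List ℕ × List ℕ, insertMax q = oneLine π ∧ q.1.length = i ∧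
      ∃ x ∈ q.1, ∀ y ∈ q.2, y < x := by
  have inj : ∀ {a b : Fin n}, (π a : ℕ) = π b → a = b := fun h => π.injective (Fin.ext h)
  constructor
  · rintro ⟨p, hp, rfl, q, hq, hqp⟩
    obtain ⟨⟨L, R⟩, e, hL, hn⟩ := exists_split_of_max hp
    have e' : oneLine π = L ++ (L.length + R.length) :: R := e.symm
    simp only at hL hn
    have hqp' := Fin.lt_def.1 hqp
    refine ⟨(L, R), e, hL, π q, (mem_split_iff e' _).1.2 ⟨q, by omega, rfl⟩, fun y hy => ?_⟩
    obtain ⟨j, hj, rfl⟩ := (mem_split_iff e' y).2.1.1 hy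
    have h2 := (π j).2
    have h3 : (π j : ℕ) ≠ π p := fun h => by
      have : (j : ℕ) = p := by rw [inj h]
      omega
    have h4 : (π j : ℕ) ≠ π q := fun h => by
      have : (j : ℕ) = q := by rw [inj h]
      omega
    omega
  · rintro ⟨⟨L, R⟩, e, rfl, x, hx, hd⟩
    have hn : splitSize (L, R) = n := by rw [← length_insertMax, e, length_oneLine]
    have e' : oneLine π = L ++ (L.length + R.length) :: R := e.symm
    simp only [splitSize] at hn
    have hp := (mem_split_iff e' 0).2.2 ⟨L.length, by omega⟩ rfl
    simp only at hd hx
    have hL := List.length_pos_of_mem hx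
    refine ⟨⟨L.length, by omega⟩, by omega, rfl, π.symm ⟨n - 2, by omega⟩, by simp; omega, ?_⟩
    set q := π.symm ⟨n - 2, by omega⟩ with hqdef
    have hπq : (π q : ℕ) = n - 2 := by simp [q]
    rw [Fin.lt_def]
    by_contra hlt
    simp only [not_lt] at hlt
    rcases hlt.lt_or_eq with hlt | heq
    · have h1 := hd (π q) ((mem_split_iff e' _).2.1.2 ⟨q, hlt, rfl⟩)
      obtain ⟨j, hj, rfl⟩ := (mem_split_iff e' x).1.1 hx
      have h2 := (π j).2
      have h3 := inj (show (π j : ℕ) = π ⟨L.length, by omega⟩ by rw [hp]; omega)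
      rw [h3] at hj
      simp at hj
    · have := (mem_split_iff e' 0).2.2 q heq.symm
      omega

theorem gf_image_insertMax {S : Set (List ℕ × List ℕ)} (hS : S ⊆ {p | IsPerm (p.1 ++ p.2)}) :
    gf (insertMax '' S) List.length wordWeight = gf S splitSize splitWeight := by
  rw [gf_image (insertMax_injOn.mono hS)]
  exact gf_congr (fun p _ => length_insertMax p) fun p hp => wordWeight_insertMax (hS hp)

theorem genF_eq_gf {k : ℕ} (hk : 1 ≤ k) : genF k = gf (avoidWords k) List.length wordWeight :=
  mk_weightSum _ (fun _ h => h.1) fun _ π => oneLine_mem_avoidWords hk π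

theorem genf_eq_gf {k i : ℕ} (hi : i + 2 ≤ k) :
    genf k i = gf (splitsRight k i) splitSize splitWeight := by
  rw [← gf_image_insertMax fun p h => h.1.2.1]
  refine mk_weightSum _ ?_ fun n π => ?_
  · rintro _ ⟨p, hp, rfl⟩
    exact hp.1.2.1.insertMax
  · rw [Set.mem_ofPred_eq, maxAtNextRight_iff, ← oneLine_mem_avoidWords (by omega)]
    constructor
    · rintro ⟨p, ⟨hp, hd⟩, e⟩
      have hpi : p.1.length = i := hp.1
      exact ⟨e ▸ (insertMax_mem_avoidWords (by omega)).2 (hpi.symm ▸ hp), p, e, hpi, hd⟩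
    · rintro ⟨h, p, e, rfl, hd⟩
      exact ⟨p, ⟨(insertMax_mem_avoidWords hi).1 (e.symm ▸ h), hd⟩, e⟩

theorem geng_eq_gf {k i : ℕ} (hi : i + 2 ≤ k) :
    geng k i = gf (splitsLeft k i) splitSize splitWeight := by
  rw [← gf_image_insertMax fun p h => h.1.2.1]
  refine mk_weightSum _ ?_ fun n π => ?_
  · rintro _ ⟨p, hp, rfl⟩
    exact hp.1.2.1.insertMax
  · rw [Set.mem_ofPred_eq, maxAtNextLeft_iff, ← oneLine_mem_avoidWords (by omega)]
    constructor
    · rintro ⟨p, ⟨hp, hd⟩, e⟩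
      have hpi : p.1.length = i := hp.1
      exact ⟨e ▸ (insertMax_mem_avoidWords (by omega)).2 (hpi.symm ▸ hp), p, e, hpi, hd⟩
    · rintro ⟨h, p, e, rfl, hd⟩
      exact ⟨p, ⟨(insertMax_mem_avoidWords hi).1 (e.symm ▸ h), hd⟩, e⟩

/-! ### Uniqueness of the solution -/

theorem X_pow_dvd_map {n : ℕ} {F : Series} (φ : Poly →+* Poly) (h : X ^ n ∣ F) :
    X ^ n ∣ PowerSeries.map φ F := by
  obtain ⟨G, rfl⟩ := h
  rw [map_mul, map_pow, map_X]
  exact Dvd.intro _ rfl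

theorem eq_of_forall_X_pow_dvd {F G : Series} (h : ∀ n, X ^ n ∣ F - G) : F = G := by
  rw [← sub_eq_zero]
  ext1 n
  exact X_pow_dvd_iff.1 (h (n + 1)) n n.lt_succ_self

/-- In the equations for `f` and `g`, the series of level `k` occur on the right-hand side only with
a factor `X`, so agreement modulo `X ^ n` improves to agreement modulo `X ^ (n + 1)`, and the
equation for `F` carries this over to `F`. -/
theorem SystemAt.X_pow_dvd {k : ℕ} (hk : 2 ≤ k) {F F' : ℕ → Series} {f f' g g' : ℕ → ℕ → Series}
    (h : SystemAt k F f g) (h' : SystemAt k F' f' g')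
    (hF : ∀ m, 2 ≤ m → m < k → F m = F' m) (n : ℕ) :
    X ^ n ∣ F k - F' k ∧ ∀ i, i + 2 ≤ k → X ^ n ∣ f k i - f' k i ∧ X ^ n ∣ g k i - g' k i := by
  induction n with
  | zero => simp
  | succ n ih =>
    have hU : X ^ n ∣ atU1 (F k) - atU1 (F' k) := by
      rw [← map_sub]
      exact X_pow_dvd_map _ ih.1
    have hX : ∀ {j : ℕ}, 1 ≤ j → ∀ {D : Series}, X ^ n ∣ D → X ^ (n + 1) ∣ X ^ j * D := by
      intro j hj D hD
      rw [pow_succ']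
      exact mul_dvd_mul (dvd_pow_self _ (by omega)) hD
    have hfg : ∀ i, i + 2 ≤ k → X ^ (n + 1) ∣ f k i - f' k i ∧ X ^ (n + 1) ∣ g k i - g' k i := by
      intro i hi
      rcases Nat.eq_zero_or_pos i with rfl | hi0
      · rw [h.f_zero, h'.f_zero, h.g_zero, h'.g_zero, sub_self, ← mul_sub, mul_assoc]
        refine ⟨Dvd.dvd.mul_left ?_ _, dvd_zero _⟩
        simpa using hX le_rfl hU
      · constructor
        · rw [h.f_eq i hi0 hi, h'.f_eq i hi0 hi, hF (k - i) (by omega) (by omega), ← mul_sub,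
            ← Finset.sum_sub_distrib]
          refine Dvd.dvd.mul_left (Finset.dvd_sum fun j hj => ?_) _
          obtain ⟨hj1, hj2⟩ := Finset.mem_Icc.1 hj
          rw [← mul_sub, mul_assoc]
          exact (hX hj1 (ih.2 (i - j) (by omega)).1).mul_left _
        · rw [h.g_eq i hi0 hi, h'.g_eq i hi0 hi, add_sub_add_comm, ← mul_sub,
            ← Finset.sum_sub_distrib]
          refine dvd_add ?_ (Finset.dvd_sum fun j hj => ?_)
          · rw [mul_assoc, mul_assoc, mul_left_comm]
            rw [mul_left_comm (C (u * v))]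
            exact hX (by omega) ((hU.mul_left _).mul_left _)
          · obtain ⟨hj1, hj2⟩ := Finset.mem_Icc.1 hj
            rw [hF (k - i + j) (by omega) (by omega), ← mul_sub, mul_assoc, mul_assoc]
            exact (hX hj1 ((ih.2 (i - j) (by omega)).2.mul_left _)).mul_left _
    refine ⟨?_, hfg⟩
    rw [h.F_eq, h'.F_eq, add_sub_add_left_eq_sub, ← Finset.sum_sub_distrib]
    refine Finset.dvd_sum fun i hi => ?_
    rw [add_sub_add_comm]
    have := hfg i (by have := Finset.mem_range.1 hi; omega)
    exact dvd_add this.1 this.2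

theorem SystemAt.unique {k : ℕ} (hk : 2 ≤ k) {F F' : ℕ → Series} {f f' g g' : ℕ → ℕ → Series}
    (h : ∀ m, 2 ≤ m → m ≤ k → SystemAt m F f g) (h' : ∀ m, 2 ≤ m → m ≤ k → SystemAt m F' f' g') :
    F k = F' k ∧ ∀ i, i + 2 ≤ k → f k i = f' k i ∧ g k i = g' k i := by
  induction k using Nat.strong_induction_on with
  | _ k ih =>
    have key := (h k hk le_rfl).X_pow_dvd hk (h' k hk le_rfl) fun m hm hmk =>
      (ih m hmk hm (fun m' h1 h2 => h m' h1 (by omega)) fun m' h1 h2 => h' m' h1 (by omega)).1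
    exact ⟨eq_of_forall_X_pow_dvd fun n => (key n).1, fun i hi =>
      ⟨eq_of_forall_X_pow_dvd fun n => ((key n).2 i hi).1,
        eq_of_forall_X_pow_dvd fun n => ((key n).2 i hi).2⟩⟩

/-! ### The functional equations -/

theorem gf_singleton_nil (w : List ℕ → Poly) :
    gf {([] : List ℕ)} List.length w = C (w []) := by
  rw [gf_of_const_size w (n := 0) (by simp), finsum_mem_singleton, pow_zero, mul_one]

theorem nil_mem_avoidWords (k : ℕ) : [] ∈ avoidWords k :=
  ⟨List.Perm.refl _, sepList_nil, trivial⟩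

theorem exists_insertMax_eq {l : List ℕ} (h : IsPerm l) (hl : l ≠ []) :
    ∃ p, insertMax p = l := by
  have hpos := List.length_pos_iff.2 hl
  have : l.length - 1 ∈ l := h.symm.subset (by simp; omega)
  obtain ⟨L, R, e⟩ := List.append_of_mem this
  have hn := congrArg List.length e
  simp only [List.length_append, List.length_cons] at hn
  refine ⟨(L, R), ?_⟩
  rw [insertMax]
  conv_rhs => rw [e]
  rw [show l.length - 1 = L.length + R.length by omega]

theorem avoidWords_eq {k : ℕ} (hk : 2 ≤ k) :
    avoidWords k = {[]} ∪ ⋃ i ∈ Finset.range (k - 1),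
      insertMax '' (splitsRight k i ∪ splitsLeft k i) := by
  ext l
  simp only [Set.mem_union, Set.mem_singleton_iff, Set.mem_iUnion, Finset.mem_range, exists_prop]
  constructor
  · intro hl
    refine or_iff_not_imp_left.2 fun hne => ?_
    obtain ⟨p, rfl⟩ := exists_insertMax_eq hl.1 hne
    have hP := isPerm_of_insertMax hl.1
    have hlt : ∀ x ∈ p.1, x < p.1.length + p.2.length := fun x hx => by
      simpa using hP.lt (List.mem_append_left _ hx)
    have hlen : p.1.length + 2 ≤ k := by
      have h1 := hl.2.2
      rw [insertMax, avoidFrom_append, List.nil_append, AvoidFrom, countP_lt_eq_length hlt] at h1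
      omega
    have hp := (insertMax_mem_avoidWords hlen).1 hl
    refine ⟨p.1.length, by omega, p, ?_, rfl⟩
    by_cases hd : ∀ x ∈ p.1, ∃ y ∈ p.2, x < y
    · exact Or.inl ⟨hp, hd⟩
    · push Not at hd
      obtain ⟨x, hx, hxy⟩ := hd
      exact Or.inr ⟨hp, x, hx, fun y hy => (hxy y hy).lt_of_ne (hP.ne_of_append x hx y hy).symm⟩
  · rintro (rfl | ⟨i, hi, p, hp, rfl⟩)
    · exact nil_mem_avoidWords k
    · have hp : p ∈ splits k i := hp.elim And.left And.left
      have hpi : p.1.length = i := hp.1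
      exact (insertMax_mem_avoidWords (by omega)).2 (hpi.symm ▸ hp)

theorem disjoint_splits (k i : ℕ) : Disjoint (splitsRight k i) (splitsLeft k i) := by
  rw [Set.disjoint_left]
  rintro p ⟨-, h⟩ ⟨-, x, hx, h'⟩
  obtain ⟨y, hy, hxy⟩ := h x hx
  exact hxy.asymm (h' y hy)

theorem splits_union_subset (k i : ℕ) :
    splitsRight k i ∪ splitsLeft k i ⊆ {p | p ∈ splits k i} :=
  Set.union_subset (fun _ h => h.1) fun _ h => h.1

theorem image_insertMax_subset {k i : ℕ} {S : Set (List ℕ × List ℕ)}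
    (hS : S ⊆ {p | p ∈ splits k i}) : insertMax '' S ⊆ {l | IsPerm l} := by
  rintro _ ⟨p, hp, rfl⟩
  exact (hS hp).2.1.insertMax

theorem genF_eq {k : ℕ} (hk : 2 ≤ k) :
    genF k = 1 + ∑ i ∈ Finset.range (k - 1), (genf k i + geng k i) := by
  have hfin : ∀ i, FiniteFibers (insertMax '' (splitsRight k i ∪ splitsLeft k i)) List.length :=
    fun i => finiteFibers_isPerm.mono (image_insertMax_subset (splits_union_subset k i))
  rw [genF_eq_gf (by omega), avoidWords_eq hk, gf_union, gf_singleton_nil, gf_biUnion]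
  · congr 1
    · simp [wordWeight, lmaxList, rmaxList]
    · refine Finset.sum_congr rfl fun i hi => ?_
      have hi' : i + 2 ≤ k := by have := Finset.mem_range.1 hi; omega
      rw [gf_image_insertMax fun p hp => (splits_union_subset k i hp).2.1, gf_union,
        genf_eq_gf hi', geng_eq_gf hi']
      · exact (finiteFibers_splits k i).mono fun _ h => h.1
      · exact (finiteFibers_splits k i).mono fun _ h => h.1
      · exact disjoint_splits k i
  · exact fun i _ => hfin i
  · intro i _ j _ hij
    rw [Set.disjoint_left]
    rintro _ ⟨p, hp, rfl⟩ ⟨q, hq, e⟩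
    have hp := splits_union_subset k i hp
    have hq := splits_union_subset k j hq
    obtain rfl := insertMax_injOn hq.2.1 hp.2.1 e
    exact hij (hp.1.symm.trans hq.1)
  · exact finiteFibers_isPerm.mono (by rintro _ rfl; exact List.Perm.refl _)
  · refine finiteFibers_isPerm.mono (Set.iUnion₂_subset fun i _ =>
      image_insertMax_subset (splits_union_subset k i))
  · rw [Set.disjoint_left]
    rintro _ rfl h
    simp [insertMax] at h

theorem atU1_genF {k : ℕ} (hk : 1 ≤ k) :
    atU1 (genF k) = gf (avoidWords k) List.length fun l => v ^ rmaxList l := by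
  rw [genF_eq_gf hk, atU1, map_gf (finiteFibers_avoidWords k)]
  refine gf_congr (fun _ _ => rfl) fun l _ => ?_
  simp [wordWeight, u, v]

theorem atU1_genF_sub_one {k : ℕ} (hk : 1 ≤ k) :
    atU1 (genF k) - 1 =
      gf {l | l ∈ avoidWords k ∧ l ≠ []} List.length fun l => v ^ rmaxList l := by
  have h : avoidWords k = {[]} ∪ {l | l ∈ avoidWords k ∧ l ≠ []} := by
    ext l
    by_cases hl : l = []
    · simp [hl, nil_mem_avoidWords]
    · simp [hl]
  rw [atU1_genF hk]
  conv_lhs => rw [h]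
  rw [gf_union, gf_singleton_nil]
  · simp [rmaxList]
  · exact finiteFibers_isPerm.mono (by rintro _ rfl; exact List.Perm.refl _)
  · exact (finiteFibers_avoidWords k).mono fun _ h => h.1
  · rw [Set.disjoint_left]
    rintro _ rfl h
    exact h.2 rfl

theorem C_sepPolyU_mul (j : ℕ) :
    C (sepPolyU j) * X ^ j =
      gf {l | l ∈ sepWords ∧ l.length = j} List.length fun l => u ^ lmaxList l := by
  have h : gf {l | l ∈ sepWords ∧ l.length = j} List.length wordWeight =
      C (sepPoly j) * X ^ j := by
    rw [gf_of_const_size wordWeight (n := j) fun _ h => h.2, sepPoly, weightSum_eq,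
      image_oneLine (T := sepWords) (fun _ h => h.1) oneLine_mem_sepWords]
  have h' := congrArg (PowerSeries.map (MvPolynomial.aeval (R := ℤ) ![u, (1 : Poly)]).toRingHom) h
  rw [map_gf (finiteFibers_sepWords.mono fun _ h => h.1), map_mul, map_pow, map_X, map_C] at h'
  refine h'.symm.trans (gf_congr (fun _ _ => rfl) fun l _ => ?_)
  simp [wordWeight, u, v]

theorem finiteFibers_splitsRight (k i : ℕ) : FiniteFibers (splitsRight k i) splitSize :=
  (finiteFibers_splits k i).mono fun _ h => h.1

theorem finiteFibers_splitsLeft (k i : ℕ) : FiniteFibers (splitsLeft k i) splitSize :=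
  (finiteFibers_splits k i).mono fun _ h => h.1

theorem lmaxList_glue {K A : List ℕ} {c d : ℕ} (h : ∀ x ∈ K, x < c) (hcd : c ≤ d) :
    lmaxList (K ++ A.map (d + ·)) = lmaxList K + lmaxList A := by
  rw [lmaxList_append_of_lt, lmaxList_map (strictMono_add d)]
  intro x hx y hy
  obtain ⟨a, -, rfl⟩ := List.mem_map.1 hy
  have := h x hx
  omega

theorem rmaxList_glue {S B : List ℕ} {c d : ℕ} (h : ∀ x ∈ S, x < c) (hcd : c ≤ d) :
    rmaxList (B.map (d + ·) ++ S) = rmaxList B + rmaxList S := by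
  rw [rmaxList_append_of_gt, rmaxList_map (strictMono_add d)]
  intro x hx y hy
  obtain ⟨a, -, rfl⟩ := List.mem_map.1 hx
  have := h y hy
  omega

theorem splitWeight_glueRight {B A K S : List ℕ} (h : IsPerm (K ++ S)) :
    splitWeight (glueRight (B, A, K, S)) =
      v ^ rmaxList B * (u ^ lmaxList A * splitWeight (K, S)) := by
  have hlt := fun x => h.lt (x := x)
  rw [List.length_append] at hlt
  simp only [splitWeight, glueRight]
  rw [lmaxList_glue (c := K.length + S.length) (fun x hx => hlt x (by simp [hx])) le_rfl,
    rmaxList_glue (c := K.length + S.length) (fun x hx => hlt x (by simp [hx])) (by omega)]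
  ring

theorem splitWeight_glueLeft {B A K S : List ℕ} (h : IsPerm (K ++ S)) :
    splitWeight (glueLeft (A, B, K, S)) =
      u ^ lmaxList A * (v ^ rmaxList B * splitWeight (K, S)) := by
  have hlt := fun x => h.lt (x := x)
  rw [List.length_append] at hlt
  simp only [splitWeight, glueLeft]
  rw [lmaxList_glue (c := K.length + S.length) (fun x hx => hlt x (by simp [hx])) (by omega),
    rmaxList_glue (c := K.length + S.length) (fun x hx => hlt x (by simp [hx])) le_rfl]
  ring

theorem splitSize_glueRight (B A K S : List ℕ) :
    splitSize (glueRight (B, A, K, S)) = B.length + (A.length + splitSize (K, S)) := by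
  simp only [splitSize, glueRight, List.length_append, List.length_map]
  omega

theorem splitSize_glueLeft (A B K S : List ℕ) :
    splitSize (glueLeft (A, B, K, S)) = A.length + (B.length + splitSize (K, S)) := by
  simp only [splitSize, glueLeft, List.length_append, List.length_map]
  omega

theorem gf_image_glue {S T : Set (List ℕ)} {P : Set (List ℕ × List ℕ)}
    {e : List ℕ × List ℕ × List ℕ × List ℕ → List ℕ × List ℕ} {w z : List ℕ → Poly}
    (he : Set.InjOn e (S ×ˢ T ×ˢ P)) (hS : S ⊆ {l | IsPerm l}) (hT : T ⊆ {l | IsPerm l})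
    (hP : FiniteFibers P splitSize)
    (hsize : ∀ a b p, splitSize (e (a, b, p)) = a.length + (b.length + splitSize p))
    (hw : ∀ a b, ∀ p ∈ P, splitWeight (e (a, b, p)) = w a * (z b * splitWeight p)) :
    gf (e '' (S ×ˢ T ×ˢ P)) splitSize splitWeight =
      gf S List.length w * (gf T List.length z * gf P splitSize splitWeight) := by
  have hS := finiteFibers_isPerm.mono hS
  have hT := finiteFibers_isPerm.mono hT
  rw [gf_image he, ← gf_prod hT hP, ← gf_prod hS (hT.prod hP)]
  exact gf_congr (fun q _ => hsize q.1 q.2.1 q.2.2) fun q hq => hw q.1 q.2.1 q.2.2 hq.2.2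

theorem genf_eq {k i : ℕ} (hi : 1 ≤ i) (hik : i + 2 ≤ k) :
    genf k i = (atU1 (genF (k - i)) - 1) *
      ∑ j ∈ Finset.Icc 1 i, C (sepPolyU j) * X ^ j * genf k (i - j) := by
  have hsub : ∀ j ∈ Finset.Icc 1 i, glueRight '' rightBlocks k i j ⊆ splitsRight k i := by
    intro j hj
    rw [splitsRight_eq hi (by omega)]
    exact Set.subset_biUnion_of_mem (u := fun j => glueRight '' rightBlocks k i j) hj
  rw [genf_eq_gf hik, splitsRight_eq hi (by omega), gf_biUnion
    (fun j hj => (finiteFibers_splitsRight k i).mono (hsub j hj)), Finset.mul_sum]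
  · refine Finset.sum_congr rfl fun j hj => ?_
    obtain ⟨hj1, hj2⟩ := Finset.mem_Icc.1 hj
    rw [genf_eq_gf (by omega), C_sepPolyU_mul, atU1_genF_sub_one (by omega)]
    exact gf_image_glue (fun q hq q' hq' e => glueRight_injective hj1 hj1 hq hq' e)
      (fun _ h => h.1.1) (fun _ h => h.1.1) (finiteFibers_splitsRight _ _)
      (fun _ _ _ => splitSize_glueRight _ _ _ _)
      fun _ _ _ hp => splitWeight_glueRight hp.1.2.1
  · intro j hj j' hj' hne
    rw [Set.disjoint_left]
    rintro _ ⟨q, hq, rfl⟩ ⟨q', hq', e⟩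
    obtain rfl := glueRight_injective (Finset.mem_Icc.1 hj').1 (Finset.mem_Icc.1 hj).1 hq' hq e
    exact hne (hq.2.1.2.symm.trans hq'.2.1.2)

theorem gf_leftCore {k i : ℕ} (hk : 1 ≤ k) :
    gf (glueLeft '' leftCore k i) splitSize splitWeight =
      C (u * v) * X ^ (i + 1) * C (sepPolyU i) * atU1 (genF k) := by
  have hinj : Set.InjOn glueLeft (leftCore k i) := by
    rintro ⟨A, B, p⟩ ⟨hA, hB, rfl⟩ ⟨A', B', p'⟩ ⟨hA', hB', rfl⟩ e
    simp only [glueLeft, Prod.mk.injEq, List.append_nil, List.nil_append] at e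
    obtain rfl : B = B' := map_add_injective _ e.2
    obtain rfl : A = A' := map_add_injective _ e.1
    rfl
  have h1 : gf {(([] : List ℕ), ([] : List ℕ))} splitSize splitWeight = C (u * v) * X := by
    rw [gf_of_const_size splitWeight (n := 1) (by rintro _ rfl; rfl), finsum_mem_singleton,
      pow_one]
    simp [splitWeight, lmaxList, rmaxList]
  have hfin : FiniteFibers {(([] : List ℕ), ([] : List ℕ))} splitSize :=
    fun n => (Set.finite_singleton _).subset fun _ h => h.1
  rw [leftCore, gf_image_glue hinj (fun _ h => h.1.1) (fun _ h => h.1) hfin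
    (fun _ _ _ => splitSize_glueLeft _ _ _ _) (w := fun l => u ^ lmaxList l)
    (z := fun l => v ^ rmaxList l), h1, ← C_sepPolyU_mul, ← atU1_genF hk]
  · ring
  · rintro A B _ rfl
    exact splitWeight_glueLeft (List.Perm.refl _)

theorem geng_eq {k i : ℕ} (hi : 1 ≤ i) (hik : i + 2 ≤ k) :
    geng k i = C (u * v) * X ^ (i + 1) * C (sepPolyU i) * atU1 (genF k) +
      ∑ j ∈ Finset.Icc 1 (i - 1),
        C (sepPolyU j) * X ^ j * (atU1 (genF (k - i + j)) - 1) * geng k (i - j) := by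
  have hsub0 : glueLeft '' leftCore k i ⊆ splitsLeft k i := by
    rw [splitsLeft_eq hi (by omega)]
    exact Set.subset_union_left
  have hsub : ⋃ j ∈ Finset.Icc 1 (i - 1), glueLeft '' leftBlocks k i j ⊆ splitsLeft k i := by
    rw [splitsLeft_eq hi (by omega)]
    exact Set.subset_union_right
  have hfin := finiteFibers_splitsLeft k i
  rw [geng_eq_gf hik, splitsLeft_eq hi (by omega), gf_union (hfin.mono hsub0) (hfin.mono hsub),
    gf_leftCore (by omega), gf_biUnion]
  · congr 1
    refine Finset.sum_congr rfl fun j hj => ?_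
    obtain ⟨hj1, hj2⟩ := Finset.mem_Icc.1 hj
    rw [geng_eq_gf (by omega), C_sepPolyU_mul, atU1_genF_sub_one (by omega), mul_assoc]
    exact gf_image_glue (fun q hq q' hq' e => glueLeft_injective hq hq' e)
      (fun _ h => h.1.1) (fun _ h => h.1.1) (finiteFibers_splitsLeft _ _)
      (fun _ _ _ => splitSize_glueLeft _ _ _ _)
      fun _ _ _ hp => splitWeight_glueLeft hp.1.2.1
  · exact fun j hj => hfin.mono ((Set.subset_biUnion_of_mem
      (u := fun j => glueLeft '' leftBlocks k i j) hj).trans hsub)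
  · intro j hj j' hj' hne
    rw [Set.disjoint_left]
    rintro _ ⟨q, hq, rfl⟩ ⟨q', hq', e⟩
    obtain rfl := glueLeft_injective hq' hq e
    exact hne (hq.1.2.symm.trans hq'.1.2)
  · exact Set.disjoint_iUnion₂_right.2 fun j _ => disjoint_glueLeft

theorem splitsRight_zero (k : ℕ) : splitsRight k 0 = Prod.mk [] '' avoidWords k := by
  have key : ∀ R, IsPerm R → (SepList (insertMax ([], R)) ↔ SepList R) := fun R hR => by
    rw [insertMax]
    simp only [List.nil_append]
    rw [← List.singleton_append, sepList_append_of_gt (by simpa using fun y => hR.lt),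
      and_iff_right (sepList_singleton _)]
  ext ⟨L, R⟩
  constructor
  · rintro ⟨⟨hL, hP, hsep, hav⟩, -⟩
    obtain rfl := List.length_eq_zero_iff.1 hL
    exact ⟨R, ⟨hP, (key R hP).1 hsep, hav⟩, rfl⟩
  · rintro ⟨R, ⟨hP, hsep, hav⟩, e⟩
    obtain ⟨rfl, rfl⟩ := Prod.mk.inj e
    exact ⟨⟨rfl, hP, (key R hP).2 hsep, hav⟩, by simp⟩

theorem genf_zero {k : ℕ} (hk : 2 ≤ k) : genf k 0 = C (u * v) * X * atU1 (genF k) := by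
  rw [genf_eq_gf (by omega), splitsRight_zero, gf_image (Prod.mk_right_injective _).injOn,
    atU1_genF (by omega)]
  have := gf_size_add (finiteFibers_avoidWords k) (fun l => v ^ rmaxList l) 1 (u * v)
  rw [pow_one] at this
  rw [← this]
  refine gf_congr (fun l _ => by simp [splitSize]) fun l _ => ?_
  simp [splitWeight, lmaxList, rmaxList]
  ring

theorem geng_zero {k : ℕ} (hk : 2 ≤ k) : geng k 0 = 0 := by
  rw [geng_eq_gf (by omega), show splitsLeft k 0 = ∅ from ?_, gf_empty]
  refine Set.eq_empty_of_forall_notMem ?_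
  rintro p ⟨⟨h, -⟩, x, hx, -⟩
  rw [List.length_eq_zero_iff.1 h] at hx
  simp at hx

/-- The substitution `u = 1` is idempotent, so it turns `uvx F_k(x,1,v)` into `vx F_k(x,1,v)`. -/
theorem atU1_genf_zero {k : ℕ} (hk : 2 ≤ k) : atU1 (genf k 0) = C v * X * atU1 (genF k) := by
  rw [genf_zero hk, atU1_genF (by omega)]
  simp only [map_mul, atU1, map_C, map_X, map_gf (finiteFibers_avoidWords k)]
  congr 1
  · simp [u, v]
  · exact gf_congr (fun _ _ => rfl) fun l _ => by simp [v]

theorem genf_two_zero : genf 2 0 = geomUV := by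
  have h := congrArg atU1 (genF_eq (le_refl 2))
  rw [Finset.sum_range_one, geng_zero le_rfl, add_zero, map_add, map_one,
    atU1_genf_zero le_rfl] at h
  -- At level `2` the equation for `F` is linear in `F(x, 1, v)`.
  have h1 : (1 - C v * X) * atU1 (genF 2) = 1 := by linear_combination h
  have h2 : (1 - C v * X : Series) * invOfUnit (1 - C v * X) 1 = 1 :=
    mul_invOfUnit _ _ (by simp)
  rw [genf_zero le_rfl, geomUV]
  congr 1
  linear_combination invOfUnit (1 - C v * X : Series) 1 * h1 - atU1 (genF 2) * h2

theorem systemAt_gen {k : ℕ} (hk : 2 ≤ k) : SystemAt k genF genf geng where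
  F_eq := genF_eq hk
  f_eq _ := genf_eq
  g_eq _ := geng_eq
  f_zero := genf_zero hk
  g_zero := geng_zero hk
  f_two_zero := genf_two_zero

end FlatPOP

theorem corollary3 (k : ℕ) (hk : 2 ≤ k) :
    FlatPOP.SystemAt k FlatPOP.genF FlatPOP.genf FlatPOP.geng ∧
    ∀ (F : ℕ → FlatPOP.Series) (f g : ℕ → ℕ → FlatPOP.Series),
      (∀ m, 2 ≤ m → m ≤ k → FlatPOP.SystemAt m F f g) →
        F k = FlatPOP.genF k ∧
        ∀ i, i + 2 ≤ k → f k i = FlatPOP.genf k i ∧ g k i = FlatPOP.geng k i :=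
  ⟨FlatPOP.systemAt_gen hk, fun _ _ _ h =>
    FlatPOP.SystemAt.unique hk h fun _ hm _ => FlatPOP.systemAt_gen hm⟩
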